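/- Let $L$, $\{A, A_i\}_{i\ge 1}$, $\{U, U_i\}_{i\ge 1}$ be non-negative random variables such that $\{A,A_i\}_{i\ge1}$ and $\{U,U_i\}_{i\ge1}$ are two i.i.d. sequences, independent of each other, and $L$ is independent of both sequences jointly. Define $$N=\inf\{n\ge 1: A_n\ge L\},\qquad T=\sum_{i=1}^{N-1}(A_i+U_i)+L,$$ and write $\bar F(x)=\mathbb P[L>x]$, $\bar G(x)=\mathbb P[A>x]$. Assume that $\bar F$ is continuous on $\mathbb R$ and $\bar F(x)>0$ for all $x\ge 0$. Let $\beta>0$ and let $\Phi(x)=e^{R_\beta(x)}$, $x>0$, be eventually non-decreasing, where $R_\beta(x)=x^\beta l(x)$ is regularly varying at infinity with index $\beta$ (that is, it is measurable and positive on some $[X,\infty)$, and $R_\beta(cx)/R_\beta(x)\to c^\beta$ as $x\to\infty$ for every $c>0$). Assume that $$\lim_{x\to\infty}\frac{\log\left(\bar F(x)^{-1}\right)}{\log\Phi\left(\bar G(x)^{-1}\right)}=1,\qquad \lim_{x\to\infty}\frac{l\left(\left(x/l(x)\right)^{1/(1+\beta)}\right)}{l(x)}=1.$$ In addition, assume that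 $\mathbb E[A]<\infty$, that for some $\delta>0$ $$\mathbb P[U>x]=O\left(e^{-(\log\Phi(x))^{(1+\delta)/(\beta+1)}}\right)\quad\text{as }x\to\infty,$$ and that $\mathbb P[L>x]=O(e^{-x^\xi})$ and $\mathbb P[A>x]=O(e^{-x^\zeta})$ as $x\to\infty$ for some $\xi>\beta/(\beta+1)$ and $\zeta\ge 0$ with $(1-\zeta)\beta<\xi$. Then $\mathbb E[A+U]<\infty$ and $$\lim_{t\to\infty}\frac{\log\left(\mathbb P[T>t]^{-1}\right)}{(\log\Phi(t))^{1/(\beta+1)}}=\frac{\beta^{1/(\beta+1)}+\beta^{-\beta/(\beta+1)}}{(\mathbb E[A+U])^{\beta/(\beta+1)}}.$$ -/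

import Mathlib

open MeasureTheory ProbabilityTheory Filter Set
open scoped Topology ENNReal

/-- `f` is regularly varying at infinity with index `ρ`: it is measurable and positive on some
half-line `[X, ∞)`, and `f (c x) / f x → c ^ ρ` as `x → ∞` for every `c > 0`. -/
def IsRegularlyVarying (f : ℝ → ℝ) (ρ : ℝ) : Prop :=
  (∃ X : ℝ, Measurable (fun x : Ici X => f x) ∧ ∀ x ∈ Ici X, 0 < f x) ∧
    ∀ c : ℝ, 0 < c → Tendsto (fun x => f (c * x) / f x) atTop (𝓝 (c ^ ρ))

/-- The complementary distribution function `x ↦ P[X > x]` of a real random variable. -/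
noncomputable def tailProb {Ω : Type*} [MeasurableSpace Ω] (μ : Measure Ω) (X : Ω → ℝ) (x : ℝ) :
    ℝ :=
  μ.real {ω | x < X ω}

/-- The probabilistic model: a data unit of size `L`, availability periods `A 1, A 2, …` and
unavailability periods `U 1, U 2, …` of the channel. All are non-negative random variables,
`{A, A_i}` and `{U, U_i}` are i.i.d. sequences (`A 0` and `U 0` are the generic variables `A`, `U`),
the two sequences are independent of each other, and `L` is independent of the channel. -/
structure IsRetransmissionModel {Ω : Type*} [MeasurableSpace Ω] (μ : Measure Ω)
    (L : Ω → ℝ) (A U : ℕ → Ω → ℝ) : Prop where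
  measurable_L : Measurable L
  measurable_A : ∀ i, Measurable (A i)
  measurable_U : ∀ i, Measurable (U i)
  nonneg_L : ∀ᵐ ω ∂μ, 0 ≤ L ω
  nonneg_A : ∀ i, ∀ᵐ ω ∂μ, 0 ≤ A i ω
  nonneg_U : ∀ i, ∀ᵐ ω ∂μ, 0 ≤ U i ω
  indep_A : iIndepFun A μ
  indep_U : iIndepFun U μ
  identDistrib_A : ∀ i, IdentDistrib (A i) (A 0) μ μ
  identDistrib_U : ∀ i, IdentDistrib (U i) (U 0) μ μ
  indep_A_U : IndepFun (fun ω i => A i ω) (fun ω i => U i ω) μ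
  indep_L_channel : IndepFun L (fun ω => ((fun i => A i ω, fun i => U i ω) : (ℕ → ℝ) × (ℕ → ℝ))) μ

/-- The number of (re)transmissions `N = inf {n ≥ 1 : A n ≥ L}`, with `inf ∅ = ∞`. -/
noncomputable def numTransmissions {Ω : Type*} (L : Ω → ℝ) (A : ℕ → Ω → ℝ) (ω : Ω) : ℕ∞ :=
  sInf ((fun n : ℕ => (n : ℕ∞)) '' {n : ℕ | 1 ≤ n ∧ L ω ≤ A n ω})

/-- The total transmission time `T = ∑_{1 ≤ i < N} (A i + U i) + L`, as an extended non-negative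
number (if `N = ∞`, the sum is an infinite series). -/
noncomputable def totalTime {Ω : Type*} (L : Ω → ℝ) (A U : ℕ → Ω → ℝ) (ω : Ω) : ℝ≥0∞ :=
  (∑' i : {i : ℕ // 1 ≤ i ∧ (i : ℕ∞) < numTransmissions L A ω},
    ENNReal.ofReal (A i ω + U i ω)) + ENNReal.ofReal (L ω)

/-! Write `m` for E[A+U], F and G for the tails of `L` and `A`. A transfer of a unit of size x fails
n times with probability about exp(-n G(x)), and n periods last about n m, so T > t needs roughly n
= t/m failures. With y = 1/G(x), the tail assumption turns P[L > x] into about exp(-R y), and having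
both costs t/(m y) + R y in the exponent. The tail of T is governed by the least cost over y.

Set r = R(t)^(1/(β+1)) and Y = t/r. The condition on l says exactly that R(Y) ~ r, so at y = w Y the
cost is about r (1/(m w) + w^β). The minimum over w is `minCost β m⁻¹`, which is the claimed
constant.

Lower bound: fix the level x of the optimal w and let n exceed t/m slightly. The event L > x, A_1,
..., A_n ≤ x, A_1 + U_1 + ... + A_n + U_n > t forces T > t. The sum falls short only with
probability exponentially small in t, and r = o(t).

Upper bound: let n be slightly below t/m. Conditioning on L, P[N > n] ≤ E[exp(-n G(L))]. Extracting
F(L)^(-s), integrable for s < 1 because F is continuous, leaves the exponential of minus the cost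
(`measureReal_forall_lt_L_le`), which is bounded uniformly in x (`eventually_forall_le_cost`,
`exists_forall_le_cost`). The rest is negligible: long units, a long U_i, or large truncated sums of
A or U. These are controlled by `exists_measureReal_sum_truncated_le` and beat exp(-κ r) for every
κ, since r grows like t^(β/(β+1)) up to arbitrarily small powers. -/

/-! ### Monotone regularly varying functions: power bounds and uniformity. -/

section RegularVariation

variable {R : ℝ → ℝ} {β x₀ : ℝ}

/-- Potter-type bound: for β < q < p, doubling the argument eventually multiplies R by at most 2^q.
Iterating over dyadic ranges, with monotonicity inside the first one, gives C x^q, and x^(p-q)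
absorbs C. -/
theorem eventually_le_rpow_of_tendsto_ratio (hβ : 0 < β) (hmono : MonotoneOn R (Ici x₀))
    (hpos : ∀ x, x₀ ≤ x → 0 < R x)
    (hrv : ∀ c : ℝ, 0 < c → Tendsto (fun x => R (c * x) / R x) atTop (𝓝 (c ^ β)))
    {p : ℝ} (hp : β < p) : ∀ᶠ x in atTop, R x ≤ x ^ p := by
  obtain ⟨q, hq1, hq2⟩ := exists_between hp
  have hlt : (2 : ℝ) ^ β < 2 ^ q := Real.rpow_lt_rpow_of_exponent_lt (by norm_num) hq1
  have h1 := (hrv 2 (by norm_num)).eventually_lt_const hlt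
  obtain ⟨X', hX'⟩ := eventually_atTop.1 h1
  set X := max X' (max x₀ 1) with hX
  have hXX' : X' ≤ X := le_max_left _ _
  have hXx0 : x₀ ≤ X := (le_max_left _ _).trans (le_max_right _ _)
  have hX1 : 1 ≤ X := (le_max_right _ _).trans (le_max_right _ _)
  have hX0 : 0 < X := by linarith
  have hstep : ∀ x, X ≤ x → R (2 * x) ≤ 2 ^ q * R x := fun x hx => by
    have := hX' x (hXX'.trans hx)
    rw [div_lt_iff₀ (hpos x (hXx0.trans hx))] at this
    exact this.le
  have hind : ∀ k : ℕ, ∀ x, X ≤ x → x ≤ 2 ^ (k + 1) * X → R x ≤ R (2 * X) * x ^ q := by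
    intro k
    induction k with
    | zero =>
      intro x hx hx2
      have h1 : R x ≤ R (2 * X) := hmono (hXx0.trans hx)
        (show x₀ ≤ 2 * X by linarith) (by simpa using hx2)
      refine h1.trans (le_mul_of_one_le_right (hpos _ (by linarith)).le ?_)
      exact Real.one_le_rpow (hX1.trans hx) (hβ.trans hq1).le
    | succ k ih =>
      intro x hx hx2
      rcases le_total x (2 * X) with h | h
      · have h1 : R x ≤ R (2 * X) := hmono (hXx0.trans hx) (show x₀ ≤ 2 * X by linarith) h
        refine h1.trans (le_mul_of_one_le_right (hpos _ (by linarith)).le ?_)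
        exact Real.one_le_rpow (hX1.trans hx) (hβ.trans hq1).le
      · have h2 := ih (x / 2) (by linarith) (by rw [pow_succ] at hx2; linarith)
        have h3 := hstep (x / 2) (by linarith)
        rw [mul_div_cancel₀ x (by norm_num : (2 : ℝ) ≠ 0)] at h3
        have h4 : (2 : ℝ) ^ q * (x / 2) ^ q = x ^ q := by
          rw [← Real.mul_rpow (by norm_num) (by linarith)]
          congr 1; ring
        calc R x ≤ 2 ^ q * R (x / 2) := h3
          _ ≤ 2 ^ q * (R (2 * X) * (x / 2) ^ q) := by gcongr
          _ = R (2 * X) * (2 ^ q * (x / 2) ^ q) := by ring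
          _ = _ := by rw [h4]
  have hlim : ∀ᶠ x : ℝ in atTop, R (2 * X) ≤ x ^ (p - q) :=
    (tendsto_rpow_atTop (by linarith)).eventually_ge_atTop _
  filter_upwards [hlim, eventually_ge_atTop X] with x hx hxX
  have hx0 : 0 < x := by linarith
  obtain ⟨k, hk⟩ := pow_unbounded_of_one_lt x (by norm_num : (1 : ℝ) < 2)
  have h1 := hind k x hxX (by
    have : (2 : ℝ) ^ k ≤ 2 ^ (k + 1) := pow_le_pow_right₀ (by norm_num) (by omega)
    nlinarith [pow_pos (by norm_num : (0 : ℝ) < 2) (k + 1)])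
  calc R x ≤ R (2 * X) * x ^ q := h1
    _ ≤ x ^ (p - q) * x ^ q := by gcongr
    _ = x ^ p := by rw [← Real.rpow_add hx0]; congr 1; ring

theorem eventually_rpow_le_of_tendsto_ratio (hmono : MonotoneOn R (Ici x₀))
    (hpos : ∀ x, x₀ ≤ x → 0 < R x)
    (hrv : ∀ c : ℝ, 0 < c → Tendsto (fun x => R (c * x) / R x) atTop (𝓝 (c ^ β)))
    {p : ℝ} (hp0 : 0 < p) (hp : p < β) : ∀ᶠ x in atTop, x ^ p ≤ R x := by
  obtain ⟨q, hq1, hq2⟩ := exists_between hp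
  have hq0 : 0 < q := hp0.trans hq1
  have hlt : (2 : ℝ) ^ q < 2 ^ β := Real.rpow_lt_rpow_of_exponent_lt (by norm_num) hq2
  have h1 := (hrv 2 (by norm_num)).eventually_const_lt hlt
  obtain ⟨X', hX'⟩ := eventually_atTop.1 h1
  set X := max X' (max x₀ 1) with hX
  have hXX' : X' ≤ X := le_max_left _ _
  have hXx0 : x₀ ≤ X := (le_max_left _ _).trans (le_max_right _ _)
  have hX1 : 1 ≤ X := (le_max_right _ _).trans (le_max_right _ _)
  have hX0 : 0 < X := by linarith
  have hstep : ∀ x, X ≤ x → 2 ^ q * R x ≤ R (2 * x) := fun x hx => by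
    have := hX' x (hXX'.trans hx)
    rw [lt_div_iff₀ (hpos x (hXx0.trans hx))] at this
    exact this.le
  have hbase : ∀ x, X ≤ x → x ≤ 2 * X → R X * (x / (2 * X)) ^ q ≤ R x := by
    intro x hx hx2
    have h1 : R X ≤ R x := hmono hXx0 (hXx0.trans hx) hx
    refine le_trans (mul_le_of_le_one_right (hpos _ hXx0).le ?_) h1
    exact Real.rpow_le_one (div_nonneg (by linarith) (by linarith)) (by rw [div_le_one (by linarith)]; exact hx2) hq0.le
  have hind : ∀ k : ℕ, ∀ x, X ≤ x → x ≤ 2 ^ (k + 1) * X → R X * (x / (2 * X)) ^ q ≤ R x := by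
    intro k
    induction k with
    | zero =>
      intro x hx hx2
      exact hbase x hx (by simpa using hx2)
    | succ k ih =>
      intro x hx hx2
      rcases le_total x (2 * X) with h | h
      · exact hbase x hx h
      · have h2 := ih (x / 2) (by linarith) (by rw [pow_succ] at hx2; linarith)
        have h3 := hstep (x / 2) (by linarith)
        rw [mul_div_cancel₀ x (by norm_num : (2 : ℝ) ≠ 0)] at h3
        have h4 : (2 : ℝ) ^ q * (x / 2 / (2 * X)) ^ q = (x / (2 * X)) ^ q := by
          rw [← Real.mul_rpow (by norm_num) (div_nonneg (by linarith) (by linarith))]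
          congr 1; ring
        calc R X * (x / (2 * X)) ^ q = 2 ^ q * (R X * (x / 2 / (2 * X)) ^ q) := by
              rw [← h4]; ring
          _ ≤ 2 ^ q * R (x / 2) := by gcongr
          _ ≤ R x := h3
  have hc : 0 < R X * (2 * X) ^ (-q) := mul_pos (hpos _ hXx0) (by positivity)
  have hlim : ∀ᶠ x : ℝ in atTop, (R X * (2 * X) ^ (-q))⁻¹ ≤ x ^ (q - p) :=
    (tendsto_rpow_atTop (by linarith)).eventually_ge_atTop _
  filter_upwards [hlim, eventually_ge_atTop X] with x hx hxX
  have hx0 : 0 < x := by linarith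
  obtain ⟨k, hk⟩ := pow_unbounded_of_one_lt x (by norm_num : (1 : ℝ) < 2)
  have h1 := hind k x hxX (by
    have : (2 : ℝ) ^ k ≤ 2 ^ (k + 1) := pow_le_pow_right₀ (by norm_num) (by omega)
    nlinarith [pow_pos (by norm_num : (0 : ℝ) < 2) (k + 1)])
  rw [inv_le_iff_one_le_mul₀ hc] at hx
  calc x ^ p = x ^ p * 1 := (mul_one _).symm
    _ ≤ x ^ p * (x ^ (q - p) * (R X * (2 * X) ^ (-q))) := by gcongr
    _ = (x ^ p * x ^ (q - p)) * (R X * (2 * X) ^ (-q)) := by ring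
    _ = x ^ q * (R X * (2 * X) ^ (-q)) := by
        rw [← Real.rpow_add hx0]; congr 2; ring
    _ = R X * (x / (2 * X)) ^ q := by
        rw [Real.div_rpow hx0.le (by linarith), Real.rpow_neg (by linarith)]; ring
    _ ≤ R x := h1

theorem tendsto_atTop_of_tendsto_ratio (hβ : 0 < β) (hmono : MonotoneOn R (Ici x₀))
    (hpos : ∀ x, x₀ ≤ x → 0 < R x)
    (hrv : ∀ c : ℝ, 0 < c → Tendsto (fun x => R (c * x) / R x) atTop (𝓝 (c ^ β))) :
    Tendsto R atTop atTop :=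
  tendsto_atTop_mono' _ (eventually_rpow_le_of_tendsto_ratio hmono hpos hrv (half_pos hβ)
    (half_lt_self hβ)) (tendsto_rpow_atTop (half_pos hβ))

/-- Uniform lower bound in the convergence `R (w y) / R y → w ^ β`, for `w` in a compact set. -/
theorem eventually_forall_mul_rpow_le (hmono : MonotoneOn R (Ici x₀))
    (hpos : ∀ x, x₀ ≤ x → 0 < R x)
    (hrv : ∀ c : ℝ, 0 < c → Tendsto (fun x => R (c * x) / R x) atTop (𝓝 (c ^ β)))
    {d M q : ℝ} (hd : 0 < d) (hq : q < 1) :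
    ∀ᶠ y in atTop, ∀ w ∈ Icc d M, q * w ^ β * R y ≤ R (w * y) := by
  refine isCompact_Icc.induction_on
    (p := fun s => ∀ᶠ y in atTop, ∀ w ∈ s, q * w ^ β * R y ≤ R (w * y)) (by simp)
    (fun s u hsu hu => hu.mono fun y h w hw => h w (hsu hw))
    (fun s u hs hu => (hs.and hu).mono fun y h w hw => hw.elim (h.1 w) (h.2 w)) ?_
  intro w₀ hw₀
  have hw₀' : 0 < w₀ := hd.trans_le hw₀.1
  have hc : Tendsto (fun v : ℝ => q * v ^ β) (𝓝 w₀) (𝓝 (q * w₀ ^ β)) :=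
    ((Real.continuousAt_rpow_const w₀ β (Or.inl hw₀'.ne')).tendsto.const_mul q)
  have hlt : q * w₀ ^ β < w₀ ^ β := by
    have : 0 < w₀ ^ β := by positivity
    nlinarith
  -- Since q < 1, some v < w₀ has v^β above q w^β for all w near w₀. The limit at the single ratio v
  -- then serves this whole neighbourhood, because R (v y) ≤ R (w y) by monotonicity.
  obtain ⟨m, hm1, hm2⟩ := exists_between hlt
  have hm : ∀ᶠ v in 𝓝 w₀, m < v ^ β ∧ 0 < v :=
    ((Real.continuousAt_rpow_const w₀ β (Or.inl hw₀'.ne')).eventually_const_lt hm2).and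
      (eventually_gt_nhds hw₀')
  obtain ⟨v, ⟨hv1, hv0⟩, hvw⟩ := (hm.filter_mono nhdsWithin_le_nhds |>.and
    (self_mem_nhdsWithin : Iio w₀ ∈ 𝓝[<] w₀)).exists
  have hvw : v < w₀ := hvw
  have e1 : ∀ᶠ w in 𝓝 w₀, q * w ^ β < m ∧ v < w :=
    (hc.eventually_lt_const hm1).and (eventually_gt_nhds hvw)
  have e2 : ∀ᶠ y in atTop, m < R (v * y) / R y ∧ x₀ ≤ y ∧ x₀ ≤ v * y ∧ 0 ≤ y :=
    ((hrv v hv0).eventually_const_lt hv1).and ((eventually_ge_atTop x₀).and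
      (((tendsto_id.const_mul_atTop hv0).eventually_ge_atTop x₀).and (eventually_ge_atTop 0)))
  refine ⟨_, mem_nhdsWithin_of_mem_nhds e1, ?_⟩
  filter_upwards [e2] with y hy w hw
  obtain ⟨h1, h2, h3, h4⟩ := hy
  obtain ⟨h5, h6⟩ := hw
  rw [lt_div_iff₀ (hpos _ h2)] at h1
  have h7 : v * y ≤ w * y := by gcongr
  calc q * w ^ β * R y ≤ m * R y := by
        have := (hpos _ h2).le
        gcongr
    _ ≤ R (v * y) := h1.le
    _ ≤ R (w * y) := hmono h3 (h3.trans h7) h7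

end RegularVariation

/-! ### The one-dimensional minimisation. -/

/-- The minimum over `w > 0` of `a / w + w ^ β`. -/
noncomputable def minCost (β a : ℝ) : ℝ :=
  a ^ (β / (β + 1)) * (β ^ (1 / (β + 1)) + β ^ (-β / (β + 1)))

theorem minCost_pos {β a : ℝ} (hβ : 0 < β) (ha : 0 < a) : 0 < minCost β a := by
  unfold minCost; positivity

theorem continuousAt_minCost {β a : ℝ} (ha : 0 < a) : ContinuousAt (minCost β) a :=
  (Real.continuousAt_rpow_const _ _ (Or.inl ha.ne')).mul_const _

/-- The minimiser w = (a/β)^(1/(β+1)) is the zero of the derivative -a/w² + β w^(β-1). -/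
theorem minCost_eq {β a : ℝ} (hβ : 0 < β) (ha : 0 < a) :
    a / (a / β) ^ (1 / (β + 1)) + ((a / β) ^ (1 / (β + 1))) ^ β = minCost β a := by
  have hb : β + 1 ≠ 0 := by positivity
  have e1 : a / (a / β) ^ (1 / (β + 1)) = a ^ (β / (β + 1)) * β ^ (1 / (β + 1)) := by
    rw [Real.div_rpow ha.le hβ.le, div_div_eq_mul_div, mul_div_right_comm]
    congr 1
    rw [div_eq_iff (by positivity), ← Real.rpow_add ha, ← add_div, div_self hb, Real.rpow_one]
  have e2 : ((a / β) ^ (1 / (β + 1))) ^ β = a ^ (β / (β + 1)) * β ^ (-β / (β + 1)) := by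
    rw [← Real.rpow_mul (by positivity), Real.div_rpow ha.le hβ.le, one_div_mul_eq_div,
      neg_div, Real.rpow_neg hβ.le, div_eq_mul_inv]
  rw [e1, e2, minCost, mul_add]

theorem minCost_le {β a w : ℝ} (hβ : 0 < β) (ha : 0 < a) (hw : 0 < w) :
    minCost β a ≤ a / w + w ^ β := by
  set v := (a / β) ^ (1 / (β + 1)) with hv
  have hv0 : 0 < v := by positivity
  have hva : v ^ β * v = a / β := by
    rw [← Real.rpow_add_one hv0.ne', hv, ← Real.rpow_mul (by positivity),
      one_div_mul_cancel (by positivity), Real.rpow_one]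
  have ha' : a = β * (v ^ β * v) := by rw [hva]; field_simp
  rw [← minCost_eq hβ ha, ← hv]
  -- Young's inequality for `z = w / v`: `β + 1 ≤ β / z + z ^ β`
  set z := w / v with hz
  have hz0 : 0 < z := by positivity
  have hwz : w = z * v := by rw [hz]; field_simp
  have hy : z ^ (β * (1 / (β + 1))) * z⁻¹ ^ (β / (β + 1)) ≤
      1 / (β + 1) * z ^ β + β / (β + 1) * z⁻¹ := by
    have := Real.geom_mean_le_arith_mean2_weighted (w₁ := 1 / (β + 1)) (w₂ := β / (β + 1))
      (p₁ := z ^ β) (p₂ := z⁻¹) (by positivity) (by positivity) (by positivity) (by positivity)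
      (by field_simp; ring)
    rwa [← Real.rpow_mul hz0.le] at this
  have hone : z ^ (β * (1 / (β + 1))) * z⁻¹ ^ (β / (β + 1)) = 1 := by
    rw [Real.inv_rpow hz0.le, mul_one_div]
    exact mul_inv_cancel₀ (by positivity)
  rw [hone] at hy
  have hy' : β + 1 ≤ z ^ β + β * z⁻¹ := by
    have h := mul_le_mul_of_nonneg_left hy (by positivity : 0 ≤ β + 1)
    have h2 : (β + 1) * (1 / (β + 1) * z ^ β + β / (β + 1) * z⁻¹) = z ^ β + β * z⁻¹ := by
      field_simp
    linarith
  have e1 : a / v = β * v ^ β := by rw [ha']; field_simp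
  have e2 : a / w = β * z⁻¹ * v ^ β := by rw [ha', hwz]; field_simp
  have e3 : w ^ β = z ^ β * v ^ β := by rw [hwz, Real.mul_rpow hz0.le hv0.le]
  rw [e1, e2, e3]
  nlinarith [mul_le_mul_of_nonneg_right hy' (by positivity : 0 ≤ v ^ β)]

/-! ### Minimising the cost on the scale Y. -/

section Scale

variable {R : ℝ → ℝ} {β x₀ : ℝ}

/-- Lower bound on the cost `a t / y + R y`, uniformly in `y`, on the scale `r t = t / Y t`. -/
theorem eventually_forall_le_cost (hβ : 0 < β) (hmono : MonotoneOn R (Ici x₀))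
    (hpos : ∀ x, x₀ ≤ x → 0 < R x)
    (hrv : ∀ c : ℝ, 0 < c → Tendsto (fun x => R (c * x) / R x) atTop (𝓝 (c ^ β)))
    {Y r : ℝ → ℝ} (hY : Tendsto Y atTop atTop) (hr : ∀ᶠ t in atTop, t / Y t = r t)
    (hYr : Tendsto (fun t => R (Y t) / r t) atTop (𝓝 1))
    {a κ : ℝ} (ha : 0 < a) (hκ0 : 0 < κ) (hκ : κ < minCost β a) :
    ∀ᶠ t in atTop, ∀ y, x₀ ≤ y → 0 < y → κ * r t ≤ a * t / y + R y := by
  have hm := minCost_pos hβ ha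
  obtain ⟨q, hq0, hq1, hqm⟩ : ∃ q : ℝ, 0 < q ∧ q < 1 ∧ κ ≤ q * q * minCost β a := by
    -- The factor q is lost twice: in R (w Y) ≥ q w^β R (Y), and in R (Y) ≥ q r.
    refine ⟨Real.sqrt (κ / minCost β a), by positivity, ?_, ?_⟩
    · rw [Real.sqrt_lt' one_pos, one_pow, div_lt_one hm]; exact hκ
    · rw [Real.mul_self_sqrt (by positivity)]
      exact (div_mul_cancel₀ _ hm.ne').ge
  -- Outside [d, M] one term suffices: for y/Y < d ≤ a/κ the term a t / y exceeds κ r, and for y/Y >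
  -- M the term R y does, as q² M^β = κ. Uniform regular variation is needed only on the compact
  -- range between.
  set M := (κ / (q * q)) ^ (1 / β) with hM
  have hM0 : 0 < M := by positivity
  have hMβ : M ^ β = κ / (q * q) := by
    rw [hM, ← Real.rpow_mul (by positivity), one_div_mul_cancel hβ.ne', Real.rpow_one]
  set d := min (a / κ) M with hd
  have hd0 : 0 < d := lt_min (by positivity) hM0
  have e1 := hY.eventually (eventually_forall_mul_rpow_le hmono hpos hrv (M := M) hd0 hq1)
  have e2 : ∀ᶠ t in atTop, q < R (Y t) / r t := hYr.eventually_const_lt hq1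
  filter_upwards [e1, e2, hr, eventually_gt_atTop 0, hY.eventually_gt_atTop 0,
    (hY.const_mul_atTop hM0).eventually_ge_atTop x₀] with t h1 h2 h3 ht hYt hMY y hy hy0
  have hr0 : 0 < r t := by rw [← h3]; positivity
  rw [lt_div_iff₀ hr0] at h2
  have htY : t = r t * Y t := by rw [← h3]; field_simp
  have hRy := hpos y hy
  rcases lt_or_ge (y / Y t) d with hlt | hge
  · have h4 : y < a / κ * Y t := by
      rw [div_lt_iff₀ hYt] at hlt
      exact hlt.trans_le (by gcongr; exact min_le_left _ _)
    have h5 : κ * r t ≤ a * t / y := by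
      rw [le_div_iff₀ hy0]
      calc κ * r t * y ≤ κ * r t * (a / κ * Y t) := by gcongr
        _ = a * (r t * Y t) := by field_simp
        _ = a * t := by rw [← htY]
    linarith
  rcases le_or_gt (y / Y t) M with hle | hgt
  · have h4 := h1 _ ⟨hge, hle⟩
    rw [div_mul_cancel₀ _ hYt.ne'] at h4
    set w := y / Y t with hw
    have hw0 : 0 < w := by positivity
    have h5 : a * t / y = a / w * r t := by
      rw [← h3, hw]; field_simp
    have h6 := minCost_le hβ ha hw0
    have hwβ : 0 < w ^ β := by positivity
    have haw : 0 < a / w := by positivity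
    calc κ * r t ≤ q * q * minCost β a * r t := by gcongr
      _ ≤ q * q * (a / w + w ^ β) * r t := by gcongr
      _ = q * q * (a / w * r t) + q * w ^ β * (q * r t) := by ring
      _ ≤ 1 * (a / w * r t) + q * w ^ β * R (Y t) := by
          gcongr
          nlinarith
      _ ≤ a * t / y + R y := by rw [h5]; linarith
  · have h4 : M * Y t ≤ y := by rw [lt_div_iff₀ hYt] at hgt; exact hgt.le
    have h5 := h1 M ⟨min_le_right _ _, le_rfl⟩
    have h6 : R (M * Y t) ≤ R y := hmono hMY hy h4
    have h7 : κ * r t ≤ q * M ^ β * R (Y t) := by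
      rw [hMβ]
      calc κ * r t = q * (κ / (q * q)) * (q * r t) := by field_simp
        _ ≤ _ := by gcongr
    have : 0 < a * t / y := by positivity
    linarith

end Scale

/-! ### Tails, moments and Chernoff bounds. -/

theorem tailProb_nonneg {Ω : Type*} [MeasurableSpace Ω] {μ : Measure Ω} (X : Ω → ℝ) (x : ℝ) :
    0 ≤ tailProb μ X x :=
  measureReal_nonneg

theorem eventually_le_exp_mul_rpow {γ c : ℝ} (hγ : 0 < γ) (hc : 0 < c) :
    ∀ᶠ x : ℝ in atTop, x ≤ Real.exp (c * x ^ γ) := by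
  filter_upwards [(isLittleO_log_rpow_atTop hγ).bound hc, eventually_gt_atTop 0] with x hx hx0
  rw [Real.norm_of_nonneg (by positivity : 0 ≤ x ^ γ)] at hx
  rw [← Real.log_le_iff_le_exp hx0]
  exact (le_abs_self _).trans hx

section Probability

variable {Ω : Type*} [MeasurableSpace Ω] {μ : Measure Ω} [IsProbabilityMeasure μ]

theorem integrable_of_measureReal_lt_le_rpow {X : Ω → ℝ} (hX : AEMeasurable X μ)
    (h0 : 0 ≤ᵐ[μ] X) {C p v₀ : ℝ} (hp : 1 < p) (hv₀ : 0 < v₀)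
    (h : ∀ v, v₀ < v → μ.real {ω | v < X ω} ≤ C * v ^ (-p)) : Integrable X μ := by
  refine ⟨hX.aestronglyMeasurable, ?_⟩
  rw [hasFiniteIntegral_iff_ofReal h0, lintegral_eq_lintegral_meas_lt μ h0 hX,
    ← Ioc_union_Ioi_eq_Ioi hv₀.le]
  refine (lintegral_union_le _ _ _).trans_lt (ENNReal.add_lt_top.2 ⟨?_, ?_⟩)
  · refine (lintegral_mono (g := fun _ => 1) fun v => prob_le_one).trans_lt ?_
    simp
  · have hi : IntegrableOn (fun v : ℝ => C * v ^ (-p)) (Ioi v₀) :=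
      (integrableOn_Ioi_rpow_of_lt (by linarith) hv₀).const_mul C
    refine lt_of_le_of_lt ?_ hi.lintegral_lt_top
    refine setLIntegral_mono' measurableSet_Ioi fun v hv => ?_
    rw [← ofReal_measureReal]
    exact ENNReal.ofReal_le_ofReal (h v hv)

theorem tailProb_antitone (X : Ω → ℝ) : Antitone (tailProb μ X) := fun _ _ h =>
  measureReal_mono fun _ hω => lt_of_le_of_lt h hω

theorem tailProb_le_one (X : Ω → ℝ) (x : ℝ) : tailProb μ X x ≤ 1 := measureReal_le_one

theorem measurable_tailProb (X : Ω → ℝ) : Measurable (tailProb μ X) :=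
  (tailProb_antitone X).measurable

theorem tendsto_tailProb_atTop {X : Ω → ℝ} (hX : Measurable X) :
    Tendsto (tailProb μ X) atTop (𝓝 0) := by
  have h := tendsto_measure_iInter_atTop (μ := μ) (s := fun x : ℝ => {ω | x < X ω})
    (fun x => (measurableSet_lt measurable_const hX).nullMeasurableSet)
    (fun a b hab ω hω => lt_of_le_of_lt hab hω) ⟨0, measure_ne_top _ _⟩
  have he : ⋂ x : ℝ, {ω | x < X ω} = ∅ := by
    ext ω
    simp only [mem_iInter, mem_ofPred_eq, mem_empty_iff_false, iff_false, not_forall, not_lt]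
    exact ⟨X ω, le_rfl⟩
  rw [he, measure_empty] at h
  exact (ENNReal.tendsto_toReal ENNReal.zero_ne_top).comp h

theorem tailProb_eq_one_of_neg {X : Ω → ℝ} (h0 : ∀ᵐ ω ∂μ, 0 ≤ X ω) {x : ℝ} (hx : x < 0) :
    tailProb μ X x = 1 := by
  have : {ω | x < X ω} =ᵐ[μ] univ := by
    filter_upwards [h0] with ω hω
    exact propext ⟨fun _ => trivial, fun _ => lt_of_lt_of_le hx hω⟩
  rw [tailProb, measureReal_congr this]
  simp

/-- The probability integral transform: `P[F̄(L) < q] ≤ q`. -/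
theorem measureReal_tailProb_lt_le {L : Ω → ℝ} (hL : Measurable L) (h0 : ∀ᵐ ω ∂μ, 0 ≤ L ω)
    (hc : Continuous (tailProb μ L)) {q : ℝ} (hq : 0 < q) :
    μ.real {ω | tailProb μ L (L ω) < q} ≤ q := by
  rcases lt_or_ge 1 q with h1 | h1
  · exact (measureReal_le_one (μ := μ)).trans h1.le
  obtain ⟨b, hb⟩ := ((tendsto_tailProb_atTop (μ := μ) hL).eventually_lt_const hq).exists
  have h2 : q ∈ Icc (tailProb μ L b) (tailProb μ L (-1)) :=
    ⟨hb.le, by rwa [tailProb_eq_one_of_neg h0 (by norm_num)]⟩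
  -- Continuity makes q a value F(x) of the tail; then F(L) < F(x) forces L > x, an event of
  -- probability q.
  obtain ⟨x, hx⟩ := mem_range_of_exists_le_of_exists_ge hc ⟨b, h2.1⟩ ⟨-1, h2.2⟩
  rw [← hx]
  refine measureReal_mono fun ω hω => ?_
  by_contra hlt
  exact absurd (tailProb_antitone (μ := μ) L (not_lt.1 hlt)) (not_le.2 hω)

/-- F(L)^(-s) exceeds v with probability at most v^(-1/s), and 1/s > 1. -/
theorem integrable_tailProb_rpow_neg {L : Ω → ℝ} (hL : Measurable L) (h0 : ∀ᵐ ω ∂μ, 0 ≤ L ω)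
    (hc : Continuous (tailProb μ L)) {s : ℝ} (hs0 : 0 < s) (hs : s < 1) :
    Integrable (fun ω => tailProb μ L (L ω) ^ (-s)) μ := by
  refine integrable_of_measureReal_lt_le_rpow (C := 1) (p := 1 / s) (v₀ := 1)
    (((measurable_tailProb L).comp hL).pow_const _).aemeasurable
    (ae_of_all _ fun ω => Real.rpow_nonneg (tailProb_nonneg _ _) _)
    (by rwa [lt_one_div one_pos hs0, one_div_one]) one_pos fun v hv => ?_
  have hv0 : 0 < v := by linarith
  refine le_trans (measureReal_mono fun ω hω => ?_)
    ((measureReal_tailProb_lt_le hL h0 hc (q := v ^ (-(1 / s))) (by positivity)).trans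
      (one_mul _).ge)
  have hω : v < tailProb μ L (L ω) ^ (-s) := hω
  rcases (tailProb_nonneg (μ := μ) L (L ω)).eq_or_lt with h | h
  · change tailProb μ L (L ω) < v ^ (-(1 / s))
    rw [← h]; positivity
  · change tailProb μ L (L ω) < v ^ (-(1 / s))
    rw [Real.rpow_neg h.le, lt_inv_comm₀ hv0 (by positivity)] at hω
    calc tailProb μ L (L ω) = (tailProb μ L (L ω) ^ s) ^ (1 / s) := by
          rw [← Real.rpow_mul h.le, mul_one_div_cancel hs0.ne', Real.rpow_one]
      _ < (v⁻¹) ^ (1 / s) := Real.rpow_lt_rpow (by positivity) hω (by positivity)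
      _ = v ^ (-(1 / s)) := by rw [Real.inv_rpow hv0.le, Real.rpow_neg hv0.le]

/-- Halving the exponent makes the tail at v of order v^(-2): the level x with x^γ = 2 log v
corresponds to v. -/
theorem integrable_exp_rpow_of_tailProb {X : Ω → ℝ} (hX : Measurable X)
    (h0 : ∀ᵐ ω ∂μ, 0 ≤ X ω) {γ : ℝ} (hγ : 0 < γ)
    (htail : tailProb μ X =O[atTop] fun x : ℝ => Real.exp (-(x ^ γ))) :
    Integrable (fun ω => Real.exp (X ω ^ γ / 2)) μ := by
  obtain ⟨C, hC⟩ := htail.bound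
  obtain ⟨b, hb⟩ := eventually_atTop.1 hC
  have hb' : ∀ x, max b 0 ≤ x → tailProb μ X x ≤ C * Real.exp (-(x ^ γ)) := fun x hx => by
    have := hb x ((le_max_left _ _).trans hx)
    rwa [Real.norm_of_nonneg (tailProb_nonneg _ _), Real.norm_of_nonneg (Real.exp_pos _).le]
      at this
  refine integrable_of_measureReal_lt_le_rpow (C := C) (p := 2)
    (v₀ := Real.exp ((max b 0) ^ γ / 2))
    (by fun_prop) (ae_of_all _ fun ω => (Real.exp_pos _).le) (by norm_num) (Real.exp_pos _)
    fun v hv => ?_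
  have hv0 : 0 < v := (Real.exp_pos _).trans hv
  have hlog : (max b 0) ^ γ < 2 * Real.log v := by
    have := (Real.lt_log_iff_exp_lt hv0).2 hv
    linarith
  have hm0 : 0 ≤ (max b 0) := le_max_right _ _
  have hl0 : 0 ≤ 2 * Real.log v := (Real.rpow_nonneg hm0 _).trans hlog.le
  set x := (2 * Real.log v) ^ (1 / γ) with hx
  have hxγ : x ^ γ = 2 * Real.log v := by
    rw [hx, ← Real.rpow_mul hl0, one_div_mul_cancel hγ.ne', Real.rpow_one]
  have hx0 : 0 ≤ x := by positivity
  have hbx : max b 0 ≤ x := by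
    rw [← hxγ] at hlog
    exact ((Real.rpow_lt_rpow_iff hm0 hx0 hγ).1 hlog).le
  have hmono : μ.real {ω | v < Real.exp (X ω ^ γ / 2)} ≤ tailProb μ X x := by
    refine ENNReal.toReal_mono (measure_ne_top _ _) (measure_mono_ae ?_)
    filter_upwards [h0] with ω hω hω2
    have hω2 : v < Real.exp (X ω ^ γ / 2) := hω2
    have h3 := (Real.log_lt_iff_lt_exp hv0).2 hω2
    have h4 : x ^ γ < X ω ^ γ := by rw [hxγ]; linarith
    exact (Real.rpow_lt_rpow_iff hx0 hω hγ).1 h4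
  refine hmono.trans ((hb' x hbx).trans_eq ?_)
  rw [hxγ, Real.rpow_def_of_pos hv0]
  congr 2
  ring

/-- For γ > 0 another quarter of the exponent absorbs the factor X. For γ = 0 the exponential is a
constant, so a finite mean is enough; this covers ζ = 0. -/
theorem integrable_mul_exp_rpow_of_tailProb {X : Ω → ℝ} (hX : Measurable X)
    (h0 : ∀ᵐ ω ∂μ, 0 ≤ X ω) (hint : Integrable X μ) {γ : ℝ} (hγ : 0 ≤ γ)
    (htail : tailProb μ X =O[atTop] fun x : ℝ => Real.exp (-(x ^ γ))) :
    Integrable (fun ω => X ω * Real.exp (1 / 4 * X ω ^ γ)) μ := by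
  rcases hγ.eq_or_lt with rfl | hγ
  · simpa using hint.mul_const _
  obtain ⟨b, hb⟩ := eventually_atTop.1 (eventually_le_exp_mul_rpow hγ (by norm_num : (0 : ℝ) < 1 / 4))
  refine Integrable.mono' ((integrable_const (|b| * Real.exp (1 / 4 * |b| ^ γ))).add
    (integrable_exp_rpow_of_tailProb hX h0 hγ htail)) (by fun_prop) ?_
  filter_upwards [h0] with ω hω
  rw [Real.norm_of_nonneg (mul_nonneg hω (Real.exp_pos _).le), Pi.add_apply]
  rcases le_total (X ω) |b| with h | h
  · refine le_add_of_le_of_nonneg ?_ (Real.exp_pos _).le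
    gcongr
  · refine le_add_of_nonneg_of_le (by positivity) ?_
    calc X ω * Real.exp (1 / 4 * X ω ^ γ)
        ≤ Real.exp (1 / 4 * X ω ^ γ) * Real.exp (1 / 4 * X ω ^ γ) := by
          gcongr
          exact hb _ ((le_abs_self b).trans h)
      _ = Real.exp (X ω ^ γ / 2) := by rw [← Real.exp_add]; congr 1; ring

theorem integrable_of_tailProb_isBigO {X : Ω → ℝ} (hX : Measurable X)
    (h0 : ∀ᵐ ω ∂μ, 0 ≤ X ω) {γ : ℝ} (hγ : 0 < γ)
    (htail : tailProb μ X =O[atTop] fun x : ℝ => Real.exp (-(x ^ γ))) : Integrable X μ := by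
  obtain ⟨b, hb⟩ := eventually_atTop.1 (eventually_le_exp_mul_rpow hγ one_half_pos)
  refine Integrable.mono' ((integrable_const |b|).add
    (integrable_exp_rpow_of_tailProb hX h0 hγ htail)) (by fun_prop) ?_
  filter_upwards [h0] with ω hω
  rw [Real.norm_of_nonneg hω, Pi.add_apply]
  rcases le_total (X ω) |b| with h | h
  · exact le_add_of_le_of_nonneg h (Real.exp_pos _).le
  · refine le_add_of_nonneg_of_le (abs_nonneg b) ((hb _ ((le_abs_self b).trans h)).trans_eq ?_)
    congr 1; ring

/-- Dominated convergence as s ↓ 0, with the integrand at s = 1/4 as dominating function. -/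
theorem exists_integral_mul_exp_rpow_le {X : Ω → ℝ} (hX : Measurable X)
    (h0 : ∀ᵐ ω ∂μ, 0 ≤ X ω) (hint : Integrable X μ) {γ : ℝ} (hγ : 0 ≤ γ)
    (htail : tailProb μ X =O[atTop] fun x : ℝ => Real.exp (-(x ^ γ))) {m : ℝ}
    (hm : ∫ ω, X ω ∂μ < m) :
    ∃ s : ℝ, 0 < s ∧ Integrable (fun ω => X ω * Real.exp (s * X ω ^ γ)) μ ∧
      ∫ ω, X ω * Real.exp (s * X ω ^ γ) ∂μ < m := by
  have hdom := integrable_mul_exp_rpow_of_tailProb hX h0 hint hγ htail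
  have hbound : ∀ s ∈ Ioc (0 : ℝ) (1 / 4), ∀ᵐ ω ∂μ, ‖X ω * Real.exp (s * X ω ^ γ)‖ ≤
      X ω * Real.exp (1 / 4 * X ω ^ γ) := by
    intro s hs
    filter_upwards [h0] with ω hω
    rw [Real.norm_of_nonneg (mul_nonneg hω (Real.exp_pos _).le)]
    have := hs.2
    gcongr
  have hev : ∀ᶠ s : ℝ in 𝓝[>] 0, s ∈ Ioc (0 : ℝ) (1 / 4) := Ioc_mem_nhdsGT (by norm_num)
  have hlim : Tendsto (fun s : ℝ => ∫ ω, X ω * Real.exp (s * X ω ^ γ) ∂μ) (𝓝[>] 0)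
      (𝓝 (∫ ω, X ω ∂μ)) := by
    refine tendsto_integral_filter_of_dominated_convergence _
      (Eventually.of_forall fun s => by fun_prop) (hev.mono hbound) hdom
      (ae_of_all _ fun ω => ?_)
    have : Continuous fun s : ℝ => X ω * Real.exp (s * X ω ^ γ) := by fun_prop
    have h := this.tendsto 0
    simp only [zero_mul, Real.exp_zero, mul_one] at h
    exact h.mono_left nhdsWithin_le_nhds
  obtain ⟨s, hs1, hs2⟩ := (hev.and (hlim.eventually_lt_const hm)).exists
  exact ⟨s, hs1.1, hdom.mono' (by fun_prop) (hbound s hs1), hs2⟩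

/-- Large deviation bound for sums of truncated i.i.d. random variables with a (possibly trivial)
Weibull-type tail. -/
theorem exists_measureReal_sum_truncated_le {X : ℕ → Ω → ℝ} (hX : ∀ i, Measurable (X i))
    (h0 : ∀ i, ∀ᵐ ω ∂μ, 0 ≤ X i ω) (hind : iIndepFun X μ)
    (hid : ∀ i, IdentDistrib (X i) (X 0) μ μ) (hint : Integrable (X 0) μ) {γ : ℝ} (hγ : 0 ≤ γ)
    (hγ1 : γ < 1) (htail : tailProb μ (X 0) =O[atTop] fun x : ℝ => Real.exp (-(x ^ γ)))
    {ε : ℝ} (hε : 0 < ε) :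
    ∃ s : ℝ, 0 < s ∧ ∀ (n : ℕ) (x : ℝ), 0 < x →
      μ.real {ω | n * (∫ ω, X 0 ω ∂μ + 2 * ε) ≤ ∑ i ∈ Finset.Icc 1 n, (Iic x).indicator id (X i ω)}
        ≤ Real.exp (-(s * x ^ (γ - 1) * ε * n)) := by
  set m := ∫ ω, X 0 ω ∂μ with hm
  obtain ⟨s, hs, hsint, hsm⟩ := exists_integral_mul_exp_rpow_le (hX 0) (h0 0) hint hγ htail
    (m := m + ε) (by linarith)
  refine ⟨s, hs, fun n x hx => ?_⟩
  -- The tilt is matched to the truncation: for 0 ≤ a ≤ x and γ < 1, θ a ≤ s a^γ. So the tilted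
  -- moment is controlled by E[X exp(s X^γ)] < m + ε, whatever x is.
  set θ := s * x ^ (γ - 1) with hθ
  have hθ0 : 0 < θ := by positivity
  set g : ℝ → ℝ := (Iic x).indicator id with hg
  have hgm : Measurable g := measurable_id.indicator measurableSet_Iic
  have hpt : ∀ᵐ ω ∂μ, Real.exp (θ * g (X 0 ω)) ≤ 1 + θ * (X 0 ω * Real.exp (s * X 0 ω ^ γ)) := by
    filter_upwards [h0 0] with ω hω
    rcases le_or_gt (X 0 ω) x with h | h
    · have e1 : g (X 0 ω) = X 0 ω := indicator_of_mem (show X 0 ω ∈ Iic x from h) _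
      rw [e1]
      have e2 : θ * X 0 ω ≤ s * X 0 ω ^ γ := by
        rcases hω.eq_or_lt with h' | h'
        · rw [← h', mul_zero]; positivity
        · have e3 : X 0 ω ^ (1 - γ) ≤ x ^ (1 - γ) := Real.rpow_le_rpow hω h (by linarith)
          have e4 : X 0 ω = X 0 ω ^ γ * X 0 ω ^ (1 - γ) := by
            rw [← Real.rpow_add h']; simp
          have e5 : x ^ (γ - 1) * x ^ (1 - γ) = 1 := by
            rw [← Real.rpow_add hx]; simp
          calc θ * X 0 ω = s * x ^ (γ - 1) * (X 0 ω ^ γ * X 0 ω ^ (1 - γ)) := by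
                rw [← e4]
            _ ≤ s * x ^ (γ - 1) * (X 0 ω ^ γ * x ^ (1 - γ)) := by gcongr
            _ = s * X 0 ω ^ γ * (x ^ (γ - 1) * x ^ (1 - γ)) := by ring
            _ = _ := by rw [e5, mul_one]
      have e6 : Real.exp (θ * X 0 ω) ≤ 1 + θ * X 0 ω * Real.exp (θ * X 0 ω) := by
        have h1 := Real.add_one_le_exp (-(θ * X 0 ω))
        have h2 : Real.exp (-(θ * X 0 ω)) * Real.exp (θ * X 0 ω) = 1 := by
          rw [← Real.exp_add]; simp
        nlinarith [Real.exp_pos (θ * X 0 ω)]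
      calc Real.exp (θ * X 0 ω) ≤ 1 + θ * X 0 ω * Real.exp (θ * X 0 ω) := e6
        _ ≤ 1 + θ * X 0 ω * Real.exp (s * X 0 ω ^ γ) := by gcongr
        _ = _ := by ring
    · have e1 : g (X 0 ω) = 0 := indicator_of_notMem (by simpa using h) _
      rw [e1, mul_zero, Real.exp_zero]
      have : 0 ≤ θ * (X 0 ω * Real.exp (s * X 0 ω ^ γ)) := by positivity
      linarith
  have hdom : Integrable (fun ω => 1 + θ * (X 0 ω * Real.exp (s * X 0 ω ^ γ))) μ :=
    (integrable_const _).add (hsint.const_mul _)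
  have hI0 : Integrable (fun ω => Real.exp (θ * g (X 0 ω))) μ := by
    refine hdom.mono' ((hgm.comp (hX 0)).const_mul θ).exp.aestronglyMeasurable ?_
    filter_upwards [hpt] with ω hω
    rwa [Real.norm_of_nonneg (Real.exp_pos _).le]
  have hmgf0 : mgf (fun ω => g (X 0 ω)) μ θ ≤ Real.exp (θ * (m + ε)) := by
    calc mgf (fun ω => g (X 0 ω)) μ θ ≤ ∫ ω, 1 + θ * (X 0 ω * Real.exp (s * X 0 ω ^ γ)) ∂μ :=
          integral_mono_ae hI0 hdom hpt
      _ = 1 + θ * ∫ ω, X 0 ω * Real.exp (s * X 0 ω ^ γ) ∂μ := by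
          rw [integral_add (integrable_const _) (hsint.const_mul _), integral_const_mul]
          simp
      _ ≤ 1 + θ * (m + ε) := by gcongr
      _ ≤ Real.exp (θ * (m + ε)) := by
          linarith [Real.add_one_le_exp (θ * (m + ε))]
  have hind' : iIndepFun (fun i ω => g (X i ω)) μ := hind.comp (fun _ => g) fun _ => hgm
  have hmeas' : ∀ i, Measurable fun ω => g (X i ω) := fun i => hgm.comp (hX i)
  have hid' : ∀ i, IdentDistrib (fun ω => g (X i ω)) (fun ω => g (X 0 ω)) μ μ := fun i =>
    (hid i).comp hgm
  have hI : ∀ i, Integrable (fun ω => Real.exp (θ * g (X i ω))) μ := fun i =>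
    (((hid' i).comp ((measurable_const_mul θ).exp)).integrable_iff).2 hI0
  have hch := measure_ge_le_exp_mul_mgf (μ := μ)
    (X := ∑ i ∈ Finset.Icc 1 n, fun ω => g (X i ω)) (n * (m + 2 * ε)) hθ0.le
    (hind'.integrable_exp_mul_sum hmeas' fun i _ => hI i)
  rw [hind'.mgf_sum hmeas'] at hch
  simp only [Finset.sum_apply] at hch
  refine hch.trans ?_
  calc Real.exp (-θ * (n * (m + 2 * ε))) * ∏ i ∈ Finset.Icc 1 n, mgf (fun ω => g (X i ω)) μ θ
      ≤ Real.exp (-θ * (n * (m + 2 * ε))) * ∏ i ∈ Finset.Icc 1 n, Real.exp (θ * (m + ε)) := by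
        gcongr with i _
        · exact fun i _ => mgf_nonneg
        · rw [mgf_congr_of_identDistrib _ _ (hid' i)]
          exact hmgf0
    _ = Real.exp (-(θ * ε * n)) := by
        rw [Finset.prod_const, Nat.card_Icc, Nat.add_sub_cancel, ← Real.exp_nat_mul,
          ← Real.exp_add]
        congr 1; ring

/-- (1 - E[exp(-θ X)])/θ tends to E[X] as θ ↓ 0, dominated by X itself. Eventually E[exp(-θ X)] ≤ 1
- θ m ≤ exp(-θ m). -/
theorem eventually_integral_exp_neg_mul_le {X : Ω → ℝ} (hX : Measurable X)
    (h0 : ∀ᵐ ω ∂μ, 0 ≤ X ω) (hint : Integrable X μ) {m : ℝ} (hm : m < ∫ ω, X ω ∂μ) :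
    ∀ᶠ θ in 𝓝[>] (0 : ℝ), ∫ ω, Real.exp (-θ * X ω) ∂μ ≤ Real.exp (-(θ * m)) := by
  have hI : ∀ θ : ℝ, 0 < θ → Integrable (fun ω => Real.exp (-θ * X ω)) μ := fun θ hθ => by
    refine (integrable_const (1 : ℝ)).mono' (by fun_prop) ?_
    filter_upwards [h0] with ω hω
    rw [Real.norm_of_nonneg (Real.exp_pos _).le, Real.exp_le_one_iff]
    nlinarith
  have hlim : Tendsto (fun θ : ℝ => ∫ ω, θ⁻¹ * (1 - Real.exp (-θ * X ω)) ∂μ) (𝓝[>] 0)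
      (𝓝 (∫ ω, X ω ∂μ)) := by
    refine tendsto_integral_filter_of_dominated_convergence X
      (Eventually.of_forall fun s => by fun_prop) ?_ hint (ae_of_all _ fun ω => ?_)
    · filter_upwards [self_mem_nhdsWithin] with θ hθ
      have hθ : 0 < θ := hθ
      filter_upwards [h0] with ω hω
      have h1 : Real.exp (-θ * X ω) ≤ 1 := by rw [Real.exp_le_one_iff]; nlinarith
      have h2 := Real.add_one_le_exp (-θ * X ω)
      rw [Real.norm_of_nonneg (mul_nonneg (by positivity) (by linarith)),
        inv_mul_le_iff₀ hθ]
      linarith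
    · have hd : HasDerivAt (fun θ : ℝ => 1 - Real.exp (-θ * X ω)) (X ω) 0 := by
        have h1 : HasDerivAt (fun θ : ℝ => -θ * X ω) (-1 * X ω) 0 :=
          (hasDerivAt_id (0 : ℝ)).neg.mul_const _
        have h2 := (h1.exp).const_sub 1
        simpa using h2
      have h3 := hd.tendsto_slope_zero_right
      simpa using h3
  filter_upwards [hlim.eventually_const_lt hm, self_mem_nhdsWithin] with θ h1 hθ
  have hθ : 0 < θ := hθ
  rw [integral_const_mul, integral_sub (integrable_const _) (hI θ hθ)] at h1
  simp only [integral_const, probReal_univ, smul_eq_mul, mul_one] at h1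
  rw [inv_mul_eq_div, lt_div_iff₀ hθ] at h1
  have := Real.add_one_le_exp (-(θ * m))
  linarith

end Probability

/-! ### Pathwise bounds on the total time. -/

section Deterministic

variable {Ω : Type*} {L : Ω → ℝ} {A U : ℕ → Ω → ℝ} {ω : Ω}

theorem numTransmissions_le {k : ℕ} (hk : 1 ≤ k) (h : L ω ≤ A k ω) :
    numTransmissions L A ω ≤ k :=
  sInf_le ⟨k, ⟨hk, h⟩, rfl⟩

theorem lt_of_lt_numTransmissions {i : ℕ} (hi : 1 ≤ i)
    (h : (i : ℕ∞) < numTransmissions L A ω) : A i ω < L ω := by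
  by_contra hc
  exact absurd (numTransmissions_le hi (not_lt.1 hc)) (not_le.2 h)

theorem lt_numTransmissions {n : ℕ} (h : ∀ i ∈ Finset.Icc 1 n, A i ω < L ω) :
    (n : ℕ∞) < numTransmissions L A ω := by
  rw [← ENat.add_one_le_iff (ENat.natCast_ne_top n)]
  refine le_sInf ?_
  rintro _ ⟨m, ⟨hm1, hm2⟩, rfl⟩
  have : n + 1 ≤ m := by
    by_contra hc
    exact absurd (h m (Finset.mem_Icc.2 ⟨hm1, by omega⟩)) (not_lt.2 hm2)
  change (n : ℕ∞) + 1 ≤ (m : ℕ∞)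
  exact_mod_cast this

theorem totalTime_eq_tsum_indicator : totalTime L A U ω =
    (∑' i, {i : ℕ | 1 ≤ i ∧ (i : ℕ∞) < numTransmissions L A ω}.indicator
      (fun i => ENNReal.ofReal (A i ω + U i ω)) i) + ENNReal.ofReal (L ω) :=
  congrArg (· + ENNReal.ofReal (L ω))
    (tsum_subtype {i : ℕ | 1 ≤ i ∧ (i : ℕ∞) < numTransmissions L A ω}
      (fun i => ENNReal.ofReal (A i ω + U i ω)))

theorem le_totalTime {n : ℕ} (hA : ∀ i, 0 ≤ A i ω) (hU : ∀ i, 0 ≤ U i ω)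
    (h : ∀ i ∈ Finset.Icc 1 n, A i ω < L ω) :
    ENNReal.ofReal (∑ i ∈ Finset.Icc 1 n, (A i ω + U i ω)) ≤ totalTime L A U ω := by
  rw [totalTime_eq_tsum_indicator]
  refine le_add_right ?_
  rw [ENNReal.ofReal_sum_of_nonneg fun i _ => add_nonneg (hA i) (hU i)]
  have hN := lt_numTransmissions h
  refine le_trans (Finset.sum_le_sum fun i hi => ?_) (ENNReal.sum_le_tsum (Finset.Icc 1 n))
  have hi' := Finset.mem_Icc.1 hi
  rw [indicator_of_mem]
  exact ⟨hi'.1, lt_of_le_of_lt (by exact_mod_cast hi'.2) hN⟩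

/-- A success within n attempts gives N ≤ n, and every earlier A_i is below L ≤ x, so neither
truncation changes a summand that counts. -/
theorem totalTime_le {n : ℕ} {x y : ℝ} (hA : ∀ i, 0 ≤ A i ω) (hU : ∀ i, 0 ≤ U i ω)
    (hx : L ω ≤ x) (hx0 : 0 ≤ x) (hy : ∀ i ∈ Finset.Icc 1 n, U i ω ≤ y)
    (h : ∃ k ∈ Finset.Icc 1 n, L ω ≤ A k ω) :
    totalTime L A U ω ≤ ENNReal.ofReal (∑ i ∈ Finset.Icc 1 n, (Iic x).indicator id (A i ω) +
      ∑ i ∈ Finset.Icc 1 n, (Iic y).indicator id (U i ω) + x) := by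
  obtain ⟨k, hk, hkL⟩ := h
  have hk' := Finset.mem_Icc.1 hk
  have hN := numTransmissions_le hk'.1 hkL
  have hgA : ∀ i, 0 ≤ (Iic x).indicator id (A i ω) := fun i =>
    indicator_apply_nonneg fun _ => hA i
  have hgU : ∀ i, 0 ≤ (Iic y).indicator id (U i ω) := fun i =>
    indicator_apply_nonneg fun _ => hU i
  rw [totalTime_eq_tsum_indicator, ENNReal.ofReal_add (add_nonneg (Finset.sum_nonneg fun i _ => hgA i)
    (Finset.sum_nonneg fun i _ => hgU i)) hx0]
  refine add_le_add ?_ (ENNReal.ofReal_le_ofReal hx)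
  rw [← Finset.sum_add_distrib, ENNReal.ofReal_sum_of_nonneg fun i _ => add_nonneg (hgA i) (hgU i)]
  have hmem : ∀ i ∈ {i : ℕ | 1 ≤ i ∧ (i : ℕ∞) < numTransmissions L A ω}, i ∈ Finset.Icc 1 n := by
    intro i hi
    have : (i : ℕ∞) < k := hi.2.trans_le hN
    have : i < k := by exact_mod_cast this
    exact Finset.mem_Icc.2 ⟨hi.1, by omega⟩
  rw [tsum_eq_sum (s := Finset.Icc 1 n) fun i hi => indicator_of_notMem (fun hc => hi (hmem i hc)) _]
  refine Finset.sum_le_sum fun i hi => ?_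
  by_cases hiN : i ∈ {i : ℕ | 1 ≤ i ∧ (i : ℕ∞) < numTransmissions L A ω}
  · rw [indicator_of_mem hiN,
      indicator_of_mem (show A i ω ∈ Iic x from (lt_of_lt_numTransmissions hiN.1 hiN.2).le.trans hx),
      indicator_of_mem (show U i ω ∈ Iic y from hy i hi)]
    rfl
  · rw [indicator_of_notMem hiN]
    exact zero_le

end Deterministic

/-! ### Finite-n probability estimates in the model. -/

namespace IsRetransmissionModel

variable {Ω : Type*} [MeasurableSpace Ω] {μ : Measure Ω} [IsProbabilityMeasure μ]
  {L : Ω → ℝ} {A U : ℕ → Ω → ℝ}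

theorem measureReal_forall_le (h : IsRetransmissionModel μ L A U) (n : ℕ) (x : ℝ) :
    μ.real {ω | ∀ i ∈ Finset.Icc 1 n, A i ω ≤ x} = (1 - tailProb μ (A 0) x) ^ n := by
  have h1 : {ω | ∀ i ∈ Finset.Icc 1 n, A i ω ≤ x} = ⋂ i ∈ Finset.Icc 1 n, A i ⁻¹' Iic x := by
    ext ω; simp
  have h2 : ∀ i, μ.real (A i ⁻¹' Iic x) = 1 - tailProb μ (A 0) x := fun i => by
    rw [measureReal_def, (h.identDistrib_A i).measure_mem_eq measurableSet_Iic, ← measureReal_def]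
    have := probReal_compl_eq_one_sub (μ := μ) (h.measurable_A 0 (measurableSet_Ioi (a := x)))
    rw [← preimage_compl, compl_Ioi] at this
    exact this
  rw [h1, measureReal_def, h.indep_A.measure_inter_preimage_eq_mul _
    (fun _ _ => measurableSet_Iic), ENNReal.toReal_prod]
  simp_rw [← measureReal_def, h2]
  simp

theorem measureReal_forall_lt_le (h : IsRetransmissionModel μ L A U) (n : ℕ) (x : ℝ) :
    μ {ω | ∀ i ∈ Finset.Icc 1 n, A i ω < x} ≤
      ENNReal.ofReal (Real.exp (-(n * tailProb μ (A 0) x))) := by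
  refine (measure_mono (t := {ω | ∀ i ∈ Finset.Icc 1 n, A i ω ≤ x})
    fun ω hω i hi => (hω i hi).le).trans ?_
  rw [← ofReal_measureReal, h.measureReal_forall_le]
  refine ENNReal.ofReal_le_ofReal ?_
  rw [← mul_neg, Real.exp_nat_mul]
  refine pow_le_pow_left₀ (by linarith [tailProb_le_one (μ := μ) (A 0) x]) ?_ n
  linarith [Real.add_one_le_exp (-tailProb μ (A 0) x)]

/-- Independence of L and the A_i allows integrating first over the A_i with L frozen. -/
theorem measure_forall_lt_L_le (h : IsRetransmissionModel μ L A U) (n : ℕ) :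
    μ {ω | ∀ i ∈ Finset.Icc 1 n, A i ω < L ω} ≤
      ∫⁻ ω, ENNReal.ofReal (Real.exp (-(n * tailProb μ (A 0) (L ω)))) ∂μ := by
  have hAm : Measurable fun ω i => A i ω := measurable_pi_lambda _ h.measurable_A
  set S : Set (ℝ × (ℕ → ℝ)) := {p | ∀ i ∈ Finset.Icc 1 n, p.2 i < p.1} with hS
  have hSm : MeasurableSet S := by
    have : S = ⋂ i ∈ Finset.Icc 1 n, {p : ℝ × (ℕ → ℝ) | p.2 i < p.1} := by ext; simp [hS]
    rw [this]
    exact Finset.measurableSet_biInter _ fun i _ =>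
      measurableSet_lt ((measurable_pi_apply i).comp measurable_snd) measurable_fst
  have hmap := (indepFun_iff_map_prod_eq_prod_map_map h.measurable_L.aemeasurable
    hAm.aemeasurable).1 (h.indep_L_channel.comp measurable_id measurable_fst)
  have : μ {ω | ∀ i ∈ Finset.Icc 1 n, A i ω < L ω} =
      (μ.map fun ω => (L ω, fun i => A i ω)) S := by
    rw [Measure.map_apply (h.measurable_L.prodMk hAm) hSm]; rfl
  rw [this, hmap]
  have := Measure.isProbabilityMeasure_map (μ := μ) hAm.aemeasurable
  rw [Measure.prod_apply hSm, lintegral_map (measurable_measure_prodMk_left hSm) h.measurable_L]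
  refine lintegral_mono fun ω => ?_
  rw [Measure.map_apply hAm (measurable_prodMk_left hSm)]
  exact h.measureReal_forall_lt_le n (L ω)

/-- Since exp(-n G) = F^(-s) exp(-(n G + s log(1/F))), a pointwise bound on the cost gives the rate
and only the moment of F(L)^(-s) remains. -/
theorem measureReal_forall_lt_L_le (h : IsRetransmissionModel μ L A U)
    (hc : Continuous (tailProb μ L)) (hpos : ∀ x, 0 < tailProb μ L x) (n : ℕ) {s k : ℝ}
    (hs0 : 0 < s) (hs1 : s < 1)
    (hk : ∀ x, k ≤ n * tailProb μ (A 0) x + s * Real.log (tailProb μ L x)⁻¹) :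
    μ.real {ω | ∀ i ∈ Finset.Icc 1 n, A i ω < L ω} ≤
      (∫ ω, tailProb μ L (L ω) ^ (-s) ∂μ) * Real.exp (-k) := by
  have hI := integrable_tailProb_rpow_neg h.measurable_L h.nonneg_L hc hs0 hs1
  have hnn : ∀ ω, 0 ≤ tailProb μ L (L ω) ^ (-s) := fun ω => Real.rpow_nonneg (tailProb_nonneg _ _) _
  rw [← integral_mul_const, measureReal_def]
  refine ENNReal.toReal_le_of_le_ofReal
    (integral_nonneg fun ω => mul_nonneg (hnn ω) (Real.exp_pos _).le) ?_
  rw [ofReal_integral_eq_lintegral_ofReal (hI.mul_const _)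
    (ae_of_all _ fun ω => mul_nonneg (hnn ω) (Real.exp_pos _).le)]
  refine (h.measure_forall_lt_L_le n).trans (lintegral_mono fun ω => ENNReal.ofReal_le_ofReal ?_)
  rw [Real.rpow_def_of_pos (hpos _), ← Real.exp_add, Real.exp_le_exp]
  have := hk (L ω)
  rw [Real.log_inv] at this
  linarith

/-- Chernoff bound at the negative parameter -θ, factorised by the independence of the two sequences
and within each. -/
theorem measureReal_sum_le_le (h : IsRetransmissionModel μ L A U) {θ a u : ℝ} (hθ : 0 ≤ θ)
    (hA : ∫ ω, Real.exp (-θ * A 0 ω) ∂μ ≤ Real.exp (-(θ * a)))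
    (hU : ∫ ω, Real.exp (-θ * U 0 ω) ∂μ ≤ Real.exp (-(θ * u))) (n : ℕ) (t : ℝ) :
    μ.real {ω | ∑ i ∈ Finset.Icc 1 n, (A i ω + U i ω) ≤ t} ≤
      Real.exp (θ * t - n * (θ * (a + u))) := by
  have hmA := h.measurable_A
  have hmU := h.measurable_U
  have hind : IndepFun (∑ i ∈ Finset.Icc 1 n, A i) (∑ i ∈ Finset.Icc 1 n, U i) μ := by
    have := h.indep_A_U.comp (φ := fun a : ℕ → ℝ => ∑ i ∈ Finset.Icc 1 n, a i)
      (ψ := fun a : ℕ → ℝ => ∑ i ∈ Finset.Icc 1 n, a i) (by fun_prop) (by fun_prop)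
    convert! this using 1 <;> ext ω <;> simp
  have hint : ∀ X : ℕ → Ω → ℝ, (∀ i, Measurable (X i)) → (∀ i, ∀ᵐ ω ∂μ, 0 ≤ X i ω) → ∀ i,
      Integrable (fun ω => Real.exp (-θ * X i ω)) μ := by
    intro X hX hX0 i
    refine (integrable_const (1 : ℝ)).mono' (by have := hX i; fun_prop) ?_
    filter_upwards [hX0 i] with ω hω
    rw [Real.norm_of_nonneg (Real.exp_pos _).le, Real.exp_le_one_iff]
    nlinarith
  have hIA := h.indep_A.integrable_exp_mul_sum hmA (s := Finset.Icc 1 n)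
    fun i _ => hint A hmA h.nonneg_A i
  have hIU := h.indep_U.integrable_exp_mul_sum hmU (s := Finset.Icc 1 n)
    fun i _ => hint U hmU h.nonneg_U i
  have hch := measure_le_le_exp_mul_mgf (μ := μ) (t := -θ)
    (X := ∑ i ∈ Finset.Icc 1 n, A i + ∑ i ∈ Finset.Icc 1 n, U i) t (by linarith)
    (hind.integrable_exp_mul_add hIA hIU)
  rw [hind.mgf_add hIA.aestronglyMeasurable hIU.aestronglyMeasurable, h.indep_A.mgf_sum hmA,
    h.indep_U.mgf_sum hmU] at hch
  have hsum : ∀ ω, ∑ i ∈ Finset.Icc 1 n, (A i ω + U i ω) =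
      (∑ i ∈ Finset.Icc 1 n, A i + ∑ i ∈ Finset.Icc 1 n, U i) ω := fun ω => by
    simp [Finset.sum_add_distrib]
  simp_rw [hsum]
  refine hch.trans ?_
  have hpA : ∏ i ∈ Finset.Icc 1 n, mgf (A i) μ (-θ) ≤ Real.exp (-(θ * a)) ^ n := by
    rw [Finset.prod_congr rfl fun i _ => mgf_congr_of_identDistrib _ _ (h.identDistrib_A i) _,
      Finset.prod_const, Nat.card_Icc, Nat.add_sub_cancel]
    exact pow_le_pow_left₀ mgf_nonneg hA n
  have hpU : ∏ i ∈ Finset.Icc 1 n, mgf (U i) μ (-θ) ≤ Real.exp (-(θ * u)) ^ n := by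
    rw [Finset.prod_congr rfl fun i _ => mgf_congr_of_identDistrib _ _ (h.identDistrib_U i) _,
      Finset.prod_const, Nat.card_Icc, Nat.add_sub_cancel]
    exact pow_le_pow_left₀ mgf_nonneg hU n
  have hpU0 : 0 ≤ ∏ i ∈ Finset.Icc 1 n, mgf (U i) μ (-θ) := Finset.prod_nonneg fun _ _ => mgf_nonneg
  calc _ ≤ Real.exp (- -θ * t) * (Real.exp (-(θ * a)) ^ n * Real.exp (-(θ * u)) ^ n) := by
        gcongr
    _ = _ := by
        rw [← Real.exp_nat_mul, ← Real.exp_nat_mul, ← Real.exp_add, ← Real.exp_add]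
        congr 1; ring

/-- Lower bound on the tail of the total time: the data unit is longer than `x`, and the first `n`
availability periods are at most `x` but last longer than `t` in total. -/
theorem le_measureReal_totalTime (h : IsRetransmissionModel μ L A U) (n : ℕ) {t : ℝ} (ht : 0 ≤ t)
    (x : ℝ) :
    tailProb μ L x * ((1 - tailProb μ (A 0) x) ^ n -
        μ.real {ω | ∑ i ∈ Finset.Icc 1 n, (A i ω + U i ω) ≤ t}) ≤
      μ.real {ω | ENNReal.ofReal t < totalTime L A U ω} := by
  have hmA := h.measurable_A
  have hmU := h.measurable_U
  set B : Set ((ℕ → ℝ) × (ℕ → ℝ)) := {p | ∀ i ∈ Finset.Icc 1 n, p.1 i ≤ x} ∩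
    {p | t < ∑ i ∈ Finset.Icc 1 n, (p.1 i + p.2 i)} with hB
  have hBm : MeasurableSet B := by
    refine MeasurableSet.inter ?_ (measurableSet_lt measurable_const (by fun_prop))
    have : {p : (ℕ → ℝ) × (ℕ → ℝ) | ∀ i ∈ Finset.Icc 1 n, p.1 i ≤ x} =
        ⋂ i ∈ Finset.Icc 1 n, {p | p.1 i ≤ x} := by ext; simp
    rw [this]
    exact Finset.measurableSet_biInter _ fun i _ =>
      measurableSet_le (by fun_prop) measurable_const
  set C : Set Ω := (fun ω => ((fun i => A i ω, fun i => U i ω) : (ℕ → ℝ) × (ℕ → ℝ))) ⁻¹' B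
  have hprod : μ.real (L ⁻¹' Ioi x ∩ C) = tailProb μ L x * μ.real C := by
    rw [measureReal_def, h.indep_L_channel.measure_inter_preimage_eq_mul _ _ measurableSet_Ioi hBm,
      ENNReal.toReal_mul]
    rfl
  have hCge : (1 - tailProb μ (A 0) x) ^ n -
      μ.real {ω | ∑ i ∈ Finset.Icc 1 n, (A i ω + U i ω) ≤ t} ≤ μ.real C := by
    rw [← h.measureReal_forall_le, sub_le_iff_le_add]
    refine (measureReal_mono fun ω hω => ?_).trans (measureReal_union_le _ _)
    rcases lt_or_ge t (∑ i ∈ Finset.Icc 1 n, (A i ω + U i ω)) with h1 | h1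
    · exact Or.inl ⟨hω, h1⟩
    · exact Or.inr h1
  calc _ ≤ tailProb μ L x * μ.real C := by
        have := tailProb_nonneg (μ := μ) L x
        gcongr
    _ = μ.real (L ⁻¹' Ioi x ∩ C) := hprod.symm
    _ ≤ _ := by
        refine ENNReal.toReal_mono (measure_ne_top _ _) (measure_mono_ae ?_)
        filter_upwards [ae_all_iff.2 h.nonneg_A, ae_all_iff.2 h.nonneg_U] with ω hA0 hU0 hω
        obtain ⟨h1, h2, h3⟩ := hω
        exact ((ENNReal.ofReal_lt_ofReal_iff_of_nonneg ht).2 h3).trans_le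
          (le_totalTime hA0 hU0 fun i hi => lt_of_le_of_lt (h2 i hi) h1)

/-- Upper bound on the tail of the total time by a union bound over the atypical events. -/
theorem measureReal_totalTime_le (h : IsRetransmissionModel μ L A U) (n : ℕ) {t x y a u : ℝ}
    (hx : 0 ≤ x) (ht : n * a + n * u + x ≤ t) :
    μ.real {ω | ENNReal.ofReal t < totalTime L A U ω} ≤
      μ.real {ω | ∀ i ∈ Finset.Icc 1 n, A i ω < L ω} + tailProb μ L x + n * tailProb μ (U 0) y +
        μ.real {ω | n * a ≤ ∑ i ∈ Finset.Icc 1 n, (Iic x).indicator id (A i ω)} +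
        μ.real {ω | n * u ≤ ∑ i ∈ Finset.Icc 1 n, (Iic y).indicator id (U i ω)} := by
  set E₁ := {ω | ∀ i ∈ Finset.Icc 1 n, A i ω < L ω}
  set E₂ := {ω | x < L ω}
  set E₃ := ⋃ i ∈ Finset.Icc 1 n, {ω | y < U i ω}
  set E₄ := {ω | n * a ≤ ∑ i ∈ Finset.Icc 1 n, (Iic x).indicator id (A i ω)}
  set E₅ := {ω | n * u ≤ ∑ i ∈ Finset.Icc 1 n, (Iic y).indicator id (U i ω)}
  have hE₃ : μ.real E₃ ≤ n * tailProb μ (U 0) y := by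
    refine (measureReal_biUnion_finset_le _ _).trans_eq ?_
    have : ∀ i, μ.real {ω | y < U i ω} = tailProb μ (U 0) y := fun i =>
      congrArg ENNReal.toReal ((h.identDistrib_U i).measure_mem_eq measurableSet_Ioi)
    simp [this]
  calc μ.real {ω | ENNReal.ofReal t < totalTime L A U ω}
      ≤ μ.real (E₁ ∪ E₂ ∪ E₃ ∪ E₄ ∪ E₅) := by
        refine ENNReal.toReal_mono (measure_ne_top _ _) (measure_mono_ae ?_)
        filter_upwards [ae_all_iff.2 h.nonneg_A, ae_all_iff.2 h.nonneg_U] with ω hA0 hU0 hω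
        by_contra hc
        have hc : ω ∉ E₁ ∪ E₂ ∪ E₃ ∪ E₄ ∪ E₅ := hc
        simp only [mem_union, not_or] at hc
        obtain ⟨⟨⟨⟨h1, h2⟩, h3⟩, h4⟩, h5⟩ := hc
        have h1 : ¬∀ i ∈ Finset.Icc 1 n, A i ω < L ω := h1
        have h2 : ¬x < L ω := h2
        have h4 : ¬n * a ≤ ∑ i ∈ Finset.Icc 1 n, (Iic x).indicator id (A i ω) := h4
        have h5 : ¬n * u ≤ ∑ i ∈ Finset.Icc 1 n, (Iic y).indicator id (U i ω) := h5
        push Not at h1 h2 h4 h5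
        have hle := totalTime_le hA0 hU0 h2 hx
          (fun i hi => not_lt.1 fun hc => h3 (mem_biUnion hi hc)) h1
        have hω : ENNReal.ofReal t < totalTime L A U ω := hω
        have hlt := lt_of_not_ge fun hge =>
          not_le.2 (hω.trans_le hle) (ENNReal.ofReal_le_ofReal hge)
        linarith
    _ ≤ μ.real E₁ + μ.real E₂ + μ.real E₃ + μ.real E₄ + μ.real E₅ := by
        refine (measureReal_union_le _ _).trans (add_le_add_left ?_ _)
        refine (measureReal_union_le _ _).trans (add_le_add_left ?_ _)
        refine (measureReal_union_le _ _).trans (add_le_add_left ?_ _)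
        exact measureReal_union_le _ _
    _ ≤ _ := by
        have : μ.real E₂ = tailProb μ L x := rfl
        rw [this]
        gcongr

end IsRetransmissionModel

/-! ### The scales r and Y. -/

/-- A regularly varying `R`, monotone and positive on `[x₀, ∞)`, with the scale `r = R ^ (1 / (β + 1))`
of the costs and the scale `Y = t / r` of the inverse tail probabilities. -/
structure IsCostScale (β x₀ : ℝ) (R Y r : ℝ → ℝ) : Prop where
  beta_pos : 0 < β
  one_le : 1 ≤ x₀
  mono : MonotoneOn R (Ici x₀)
  pos : ∀ x, x₀ ≤ x → 0 < R x
  tendsto_ratio : ∀ c : ℝ, 0 < c → Tendsto (fun x => R (c * x) / R x) atTop (𝓝 (c ^ β))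
  r_eq : ∀ t, r t = R t ^ (1 / (β + 1))
  tendsto_Y : Tendsto Y atTop atTop
  div_Y : ∀ᶠ t in atTop, t / Y t = r t
  tendsto_R_Y : Tendsto (fun t => R (Y t) / r t) atTop (𝓝 1)

/-- Y is the argument (t / l t)^(1/(1+β)) from the condition on l. As l t = R t / t^β, it equals
t/r, and R (Y) / r = l (Y) / l (t). It diverges because R t ≤ t^(β + 1/2) eventually. -/
theorem exists_isCostScale {Φ R l : ℝ → ℝ} {β : ℝ} (hβ : 0 < β)
    (hΦ : ∀ x : ℝ, 0 < x → Φ x = Real.exp (R x)) (hR : ∀ x : ℝ, 0 < x → R x = x ^ β * l x)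
    (hΦ_mono : ∃ x₀ : ℝ, MonotoneOn Φ (Ici x₀)) (hR_rv : IsRegularlyVarying R β)
    (hl : Tendsto (fun x : ℝ => l ((x / l x) ^ (1 / (1 + β))) / l x) atTop (𝓝 1)) :
    ∃ x₀ Y, IsCostScale β x₀ R Y fun t => R t ^ (1 / (β + 1)) := by
  obtain ⟨x₁, hx₁⟩ := hΦ_mono
  obtain ⟨⟨X, -, hX⟩, hrv⟩ := hR_rv
  set x₀ := max (max x₁ X) 1 with hx₀
  have h1 : 1 ≤ x₀ := le_max_right _ _
  have hx₁₀ : x₁ ≤ x₀ := (le_max_left _ _).trans (le_max_left _ _)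
  have hX₀ : X ≤ x₀ := (le_max_right _ _).trans (le_max_left _ _)
  have hmono : MonotoneOn R (Ici x₀) := fun a ha b hb hab => by
    have ha : x₀ ≤ a := ha
    have hb : x₀ ≤ b := hb
    have := hx₁ (hx₁₀.trans ha) (hx₁₀.trans hb) hab
    rwa [hΦ a (by linarith), hΦ b (by linarith), Real.exp_le_exp] at this
  have hpos : ∀ x, x₀ ≤ x → 0 < R x := fun x hx => hX x (hX₀.trans hx)
  have hb1 : 0 < 1 + β := by linarith
  have hY : ∀ t, x₀ ≤ t → (t / l t) ^ (1 / (1 + β)) = t / R t ^ (1 / (β + 1)) := by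
    intro t ht
    have ht0 : 0 < t := by linarith
    have hRt := hpos t ht
    have e1 : t / l t = t ^ (1 + β) / R t := by
      rw [hR t ht0, Real.rpow_add ht0, Real.rpow_one, mul_comm (t ^ β), mul_div_mul_right]
      positivity
    rw [e1, Real.div_rpow (by positivity) hRt.le, ← Real.rpow_mul ht0.le,
      mul_one_div_cancel hb1.ne', Real.rpow_one, add_comm 1 β]
  have hYlim : Tendsto (fun t => (t / l t) ^ (1 / (1 + β))) atTop atTop := by
    have hlow : ∀ᶠ t in atTop, t ^ (1 / (2 * (1 + β))) ≤ (t / l t) ^ (1 / (1 + β)) := by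
      filter_upwards [eventually_le_rpow_of_tendsto_ratio hβ hmono hpos hrv
        (by linarith : β < β + 1 / 2), eventually_ge_atTop x₀] with t h2 ht
      have ht0 : 0 < t := by linarith
      rw [hY t ht, le_div_iff₀ (Real.rpow_pos_of_pos (hpos t ht) _)]
      calc t ^ (1 / (2 * (1 + β))) * R t ^ (1 / (β + 1))
          ≤ t ^ (1 / (2 * (1 + β))) * (t ^ (β + 1 / 2)) ^ (1 / (β + 1)) := by
            have := (hpos t ht).le
            gcongr
        _ = t ^ (1 : ℝ) := by
            rw [← Real.rpow_mul ht0.le, ← Real.rpow_add ht0]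
            congr 1
            field_simp
            ring
        _ = t := Real.rpow_one t
    exact tendsto_atTop_mono' _ hlow (tendsto_rpow_atTop (by positivity))
  refine ⟨x₀, fun t => (t / l t) ^ (1 / (1 + β)), hβ, h1, hmono, hpos, hrv, fun _ => rfl, hYlim,
    ?_, ?_⟩
  · filter_upwards [eventually_ge_atTop x₀] with t ht
    have := Real.rpow_pos_of_pos (hpos t ht) (1 / (β + 1))
    rw [hY t ht]
    field_simp [(by linarith : t ≠ 0)]
  · refine hl.congr' ?_
    filter_upwards [eventually_ge_atTop x₀, hYlim.eventually_gt_atTop 0] with t ht hY0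
    have ht0 : 0 < t := by linarith
    have hRt := hpos t ht
    rw [hR _ hY0, hY t ht]
    set r := R t ^ (1 / (β + 1)) with hr
    have hr0 : 0 < r := Real.rpow_pos_of_pos hRt _
    have hrR : r ^ β * r = R t := by
      rw [← Real.rpow_add_one hr0.ne', hr, ← Real.rpow_mul hRt.le,
        one_div_mul_cancel (by positivity), Real.rpow_one]
    have hlt : l t = R t / t ^ β := by rw [hR t ht0]; field_simp
    rw [hlt, ← hrR, Real.div_rpow ht0.le hr0.le]
    have : 0 < t ^ β := by positivity
    have : 0 < r ^ β := by positivity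
    field_simp

namespace IsCostScale

variable {β x₀ : ℝ} {R Y r : ℝ → ℝ}

theorem tendsto_r (h : IsCostScale β x₀ R Y r) : Tendsto r atTop atTop := by
  have hb := h.beta_pos
  have := (tendsto_rpow_atTop (by positivity : 0 < 1 / (β + 1))).comp
    (tendsto_atTop_of_tendsto_ratio hb h.mono h.pos h.tendsto_ratio)
  exact this.congr fun t => (h.r_eq t).symm

theorem eventually_r_le (h : IsCostScale β x₀ R Y r) {p : ℝ} (hp : β / (β + 1) < p) :
    ∀ᶠ t in atTop, r t ≤ t ^ p := by
  have hb := h.beta_pos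
  have hb1 : 0 < β + 1 := by linarith
  filter_upwards [eventually_le_rpow_of_tendsto_ratio hb h.mono h.pos h.tendsto_ratio
    ((div_lt_iff₀ hb1).1 hp), eventually_ge_atTop x₀] with t ht hx
  have ht0 : 0 ≤ t := by linarith [h.one_le]
  rw [h.r_eq]
  calc R t ^ (1 / (β + 1)) ≤ (t ^ (p * (β + 1))) ^ (1 / (β + 1)) :=
        Real.rpow_le_rpow (h.pos t hx).le ht (by positivity)
    _ = t ^ p := by
        rw [← Real.rpow_mul ht0]
        congr 1
        field_simp

/-- The scale `r` is sublinear. -/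
theorem eventually_mul_r_le (h : IsCostScale β x₀ R Y r) (K : ℝ) {c : ℝ} (hc : 0 < c) :
    ∀ᶠ t in atTop, K * r t ≤ c * t := by
  have hb := h.beta_pos
  obtain ⟨p, hp1, hp2⟩ := exists_between (show β / (β + 1) < 1 by
    rw [div_lt_one (by linarith)]; linarith)
  have hlim : ∀ᶠ t : ℝ in atTop, |K| / c ≤ t ^ (1 - p) :=
    (tendsto_rpow_atTop (by linarith)).eventually_ge_atTop _
  filter_upwards [h.eventually_r_le hp1, hlim, eventually_gt_atTop 0,
    h.tendsto_r.eventually_ge_atTop 0] with t h1 h2 ht hr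
  rw [div_le_iff₀ hc] at h2
  calc K * r t ≤ |K| * r t := by gcongr; exact le_abs_self K
    _ ≤ (t ^ (1 - p) * c) * t ^ p := by gcongr
    _ = c * (t ^ (1 - p) * t ^ p) := by ring
    _ = c * t := by rw [← Real.rpow_add ht]; simp

/-- For β/(β+1) < q < p, r ≤ t^q eventually, so t^p dominates κ r together with the logarithm of the
prefactor. The factor t + 1 leaves room for a union bound over n = O(t) periods. -/
theorem eventually_exp_neg_le (h : IsCostScale β x₀ R Y r) {p c : ℝ} (hp : β / (β + 1) < p)
    (hc : 0 < c) (C κ : ℝ) :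
    ∀ᶠ t in atTop, C * (t + 1) * Real.exp (-(c * t ^ p)) ≤ Real.exp (-(κ * r t)) := by
  have hb := h.beta_pos
  obtain ⟨q, hq1, hq2⟩ := exists_between hp
  have hq0 : 0 < q := lt_trans (by positivity) hq1
  have hlim : ∀ᶠ t : ℝ in atTop, (|κ| + 3) / c ≤ t ^ (p - q) :=
    (tendsto_rpow_atTop (by linarith)).eventually_ge_atTop _
  filter_upwards [h.eventually_r_le hq1, hlim, eventually_ge_atTop 1, eventually_ge_atTop |C|,
    h.tendsto_r.eventually_ge_atTop 0, eventually_le_exp_mul_rpow hq0 one_pos] with t h1 h2 ht hC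
    hr h3
  have ht0 : 0 < t := by linarith
  rw [one_mul] at h3
  rw [div_le_iff₀ hc] at h2
  have h4 : C * (t + 1) ≤ Real.exp (3 * t ^ q) := by
    have e1 : (1 : ℝ) + 1 ≤ Real.exp (t ^ q) := by
      have : 1 ≤ t ^ q := Real.one_le_rpow ht hq0.le
      linarith [Real.add_one_le_exp (t ^ q)]
    calc C * (t + 1) ≤ t * (t * 2) := by
          have : C ≤ t := (le_abs_self C).trans hC
          gcongr
          linarith
      _ ≤ Real.exp (t ^ q) * (Real.exp (t ^ q) * Real.exp (t ^ q)) := by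
          gcongr
          linarith
      _ = Real.exp (3 * t ^ q) := by
          rw [← Real.exp_add, ← Real.exp_add]; congr 1; ring
  calc C * (t + 1) * Real.exp (-(c * t ^ p)) ≤ Real.exp (3 * t ^ q) * Real.exp (-(c * t ^ p)) := by
        gcongr
    _ = Real.exp (3 * t ^ q - c * t ^ p) := by rw [← Real.exp_add]; rfl
    _ ≤ Real.exp (-(κ * r t)) := by
        rw [Real.exp_le_exp]
        have e2 : (|κ| + 3) * t ^ q ≤ c * t ^ p := by
          calc (|κ| + 3) * t ^ q ≤ t ^ (p - q) * c * t ^ q := by gcongr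
            _ = c * (t ^ (p - q) * t ^ q) := by ring
            _ = c * t ^ p := by rw [← Real.rpow_add ht0]; simp
        have e3 : κ * r t ≤ |κ| * t ^ q := by
          have := le_abs_self κ
          gcongr
        linarith

theorem eventually_mul_exp_neg_le (h : IsCostScale β x₀ R Y r) {κ κ' : ℝ} (hκ : κ < κ') (C : ℝ) :
    ∀ᶠ t in atTop, C * Real.exp (-(κ' * r t)) ≤ Real.exp (-(κ * r t)) := by
  filter_upwards [(h.tendsto_r.const_mul_atTop (sub_pos.2 hκ)).eventually_ge_atTop C] with t ht
  have h1 : C ≤ Real.exp ((κ' - κ) * r t) := by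
    linarith [Real.add_one_le_exp ((κ' - κ) * r t)]
  calc C * Real.exp (-(κ' * r t)) ≤ Real.exp ((κ' - κ) * r t) * Real.exp (-(κ' * r t)) := by gcongr
    _ = _ := by rw [← Real.exp_add]; congr 1; ring

end IsCostScale

/-! ### Asymptotic lower bound for the tail of T. -/

namespace IsRetransmissionModel

variable {Ω : Type*} [MeasurableSpace Ω] {μ : Measure Ω} [IsProbabilityMeasure μ]
  {L : Ω → ℝ} {A U : ℕ → Ω → ℝ} {β x₀ : ℝ} {R Y r : ℝ → ℝ}

/-- A level `x t` for the data unit with `P[L > x t] = exp (-w ^ β r t)`; the probability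
`P[A > x t]` is then at most of the order `1 / (w Y t)`. -/
theorem exists_level (h : IsRetransmissionModel μ L A U)
    (hs : IsCostScale β x₀ R Y r) (hc : Continuous (tailProb μ L))
    (hLpos : ∀ x, 0 < tailProb μ L x) (hApos : ∀ x, 0 < tailProb μ (A 0) x)
    (hLA : Tendsto (fun x => Real.log (tailProb μ L x)⁻¹ / R (tailProb μ (A 0) x)⁻¹) atTop (𝓝 1))
    {w q : ℝ} (hw0 : 0 < w) (hq0 : 0 < q) (hq1 : q < 1) :
    ∃ x : ℝ → ℝ, (∀ᶠ t in atTop, tailProb μ L (x t) = Real.exp (-(w ^ β * r t))) ∧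
      Tendsto (fun t => tailProb μ (A 0) (x t)) atTop (𝓝 0) ∧
      ∀ᶠ t in atTop, q * w * Y t ≤ (tailProb μ (A 0) (x t))⁻¹ := by
  have hβ := hs.beta_pos
  set H : ℝ → ℝ := fun x => Real.log (tailProb μ L x)⁻¹ with hH
  have hHmono : Monotone H := fun x y hxy =>
    Real.log_le_log (inv_pos.2 (hLpos x)) (inv_anti₀ (hLpos y) (tailProb_antitone L hxy))
  have hHcont : Continuous H := (hc.inv₀ fun x => (hLpos x).ne').log fun x =>
    (inv_pos.2 (hLpos x)).ne'
  have hHlim : Tendsto H atTop atTop := by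
    refine Real.tendsto_log_atTop.comp (tendsto_inv_nhdsGT_zero.comp ?_)
    exact tendsto_nhdsWithin_iff.2 ⟨tendsto_tailProb_atTop h.measurable_L,
      Eventually.of_forall hLpos⟩
  have hH1 : H (-1) = 0 := by
    simp [hH, tailProb_eq_one_of_neg h.nonneg_L (by norm_num : (-1 : ℝ) < 0)]
  -- Intermediate values give a right inverse of H on [0, ∞); the starting point -1 works because L
  -- ≥ 0 almost surely, so H (-1) = 0.
  have hex : ∀ v : ℝ, ∃ x, 0 ≤ v → H x = v := by
    intro v
    by_cases hv : 0 ≤ v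
    · obtain ⟨y, hy⟩ := (hHlim.eventually_ge_atTop v).exists
      obtain ⟨x, hx⟩ := mem_range_of_exists_le_of_exists_ge hHcont
        ⟨-1, by rw [hH1]; exact hv⟩ ⟨y, hy⟩
      exact ⟨x, fun _ => hx⟩
    · exact ⟨0, fun h => absurd h hv⟩
  choose ψ hψ using hex
  set x : ℝ → ℝ := fun t => ψ (w ^ β * r t) with hx
  have hwr : Tendsto (fun t => w ^ β * r t) atTop atTop :=
    hs.tendsto_r.const_mul_atTop (by positivity)
  have hHx : ∀ᶠ t in atTop, H (x t) = w ^ β * r t := by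
    filter_upwards [hwr.eventually_ge_atTop 0] with t ht using hψ _ ht
  have hxlim : Tendsto x atTop atTop := by
    refine tendsto_atTop.2 fun M => ?_
    filter_upwards [hHx, hwr.eventually_gt_atTop (H M)] with t h1 h2
    rw [← h1] at h2
    exact (hHmono.reflect_lt h2).le
  set g : ℝ → ℝ := fun t => tailProb μ (A 0) (x t) with hg
  have hglim : Tendsto g atTop (𝓝 0) := (tendsto_tailProb_atTop (h.measurable_A 0)).comp hxlim
  have hginv : Tendsto (fun t => (g t)⁻¹) atTop atTop := tendsto_inv_nhdsGT_zero.comp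
    (tendsto_nhdsWithin_iff.2 ⟨hglim, Eventually.of_forall fun t => hApos _⟩)
  have hqw : (q * w) ^ β < w ^ β :=
    Real.rpow_lt_rpow (by positivity) (by nlinarith) hβ
  -- The gap (q w)^β < c < w^β drives the contradiction below: if 1/G(x) < q w Y, then R (1/G(x)) <
  -- c r, whereas H (x) = w^β r is asymptotic to R (1/G(x)).
  obtain ⟨c, hc1, hc2⟩ := exists_between hqw
  have hc0 : 0 < c := lt_trans (by positivity) hc1
  have hRlim : Tendsto (fun t => R (q * w * Y t) / r t) atTop (𝓝 ((q * w) ^ β)) := by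
    have h1 := ((hs.tendsto_ratio (q * w) (by positivity)).comp hs.tendsto_Y).mul hs.tendsto_R_Y
    rw [mul_one] at h1
    refine h1.congr' ?_
    filter_upwards [hs.tendsto_Y.eventually_ge_atTop x₀] with t ht
    have := (hs.pos _ ht).ne'
    simp only [Function.comp]
    field_simp
  have hgY : ∀ᶠ t in atTop, q * w * Y t ≤ (g t)⁻¹ := by
    filter_upwards [hRlim.eventually_lt_const hc1, (hLA.comp hxlim).eventually_lt_const
      (show 1 < w ^ β / c by rwa [one_lt_div hc0]), hHx, hs.tendsto_r.eventually_gt_atTop 0,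
      hginv.eventually_ge_atTop x₀] with t h1 h2 h3 hr hgx
    by_contra! hlt
    have h4 : R (g t)⁻¹ ≤ R (q * w * Y t) := hs.mono hgx (hgx.trans hlt.le) hlt.le
    have h5 := hs.pos _ hgx
    have h2 : H (x t) / R (g t)⁻¹ < w ^ β / c := h2
    rw [h3, div_lt_div_iff₀ h5 hc0] at h2
    rw [div_lt_iff₀ hr] at h1
    have h6 : w ^ β * r t * c < w ^ β * (c * r t) := by
      calc w ^ β * r t * c < w ^ β * R (g t)⁻¹ := h2
        _ ≤ w ^ β * R (q * w * Y t) := by gcongr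
        _ < w ^ β * (c * r t) := by gcongr
    linarith
  refine ⟨x, ?_, hglim, hgY⟩
  filter_upwards [hHx] with t h2
  rw [← h2]
  simp only [hH]
  rw [Real.log_inv, neg_neg, Real.exp_log (hLpos _)]

theorem eventually_le_measureReal_totalTime (h : IsRetransmissionModel μ L A U)
    (hs : IsCostScale β x₀ R Y r) (hc : Continuous (tailProb μ L))
    (hLpos : ∀ x, 0 < tailProb μ L x) (hApos : ∀ x, 0 < tailProb μ (A 0) x)
    (hLA : Tendsto (fun x => Real.log (tailProb μ L x)⁻¹ / R (tailProb μ (A 0) x)⁻¹) atTop (𝓝 1))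
    (hA : Integrable (A 0) μ) (hU : Integrable (U 0) μ)
    (hm : 0 < ∫ ω, A 0 ω ∂μ + ∫ ω, U 0 ω ∂μ) {κ : ℝ}
    (hκ : minCost β (∫ ω, A 0 ω ∂μ + ∫ ω, U 0 ω ∂μ)⁻¹ < κ) :
    ∀ᶠ t in atTop, Real.exp (-(κ * r t)) ≤ μ.real {ω | ENNReal.ofReal t < totalTime L A U ω} := by
  have hβ := hs.beta_pos
  set m := ∫ ω, A 0 ω ∂μ + ∫ ω, U 0 ω ∂μ with hmdef
  obtain ⟨b, hbm, hbκ⟩ : ∃ b, m⁻¹ < b ∧ minCost β b < κ := by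
    have h1 : ∀ᶠ b in 𝓝[>] m⁻¹, minCost β b < κ :=
      ((continuousAt_minCost (inv_pos.2 hm)).eventually_lt_const hκ).filter_mono nhdsWithin_le_nhds
    obtain ⟨b, h2, h3⟩ := (h1.and self_mem_nhdsWithin).exists
    exact ⟨b, h3, h2⟩
  have hb0 : 0 < b := (inv_pos.2 hm).trans hbm
  obtain ⟨κ', hκ1, hκ2⟩ := exists_between hbκ
  have hcost := minCost_pos hβ hb0
  -- the slack `q`
  obtain ⟨q, hq0, hq1, hqκ⟩ : ∃ q : ℝ, 0 < q ∧ q < 1 ∧ (q ^ 3)⁻¹ * minCost β b ≤ κ' := by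
    have h1 : Tendsto (fun q : ℝ => (q ^ 3)⁻¹ * minCost β b) (𝓝[<] 1)
        (𝓝 (((1 : ℝ) ^ 3)⁻¹ * minCost β b)) :=
      ((((continuous_pow 3).tendsto (1 : ℝ)).inv₀ (by norm_num)).mul_const _).mono_left
        nhdsWithin_le_nhds
    rw [one_pow, inv_one, one_mul] at h1
    obtain ⟨q, h2, h3, h4⟩ := ((h1.eventually_lt_const hκ1).and
      (Ioo_mem_nhdsLT (by norm_num : (0 : ℝ) < 1))).exists
    exact ⟨q, h3, h4, h2.le⟩
  -- With means lowered by ε each, n ≥ b t periods still outlast t, so the Chernoff exponent is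
  -- negative and linear in t.
  obtain ⟨ε, hε0, hε⟩ : ∃ ε : ℝ, 0 < ε ∧ 1 < b * (m - 2 * ε) := by
    have h1 : 1 < b * m := by rwa [inv_lt_iff_one_lt_mul₀ hm] at hbm
    refine ⟨(b * m - 1) / (4 * b), div_pos (by linarith) (by linarith), ?_⟩
    have : b * (m - 2 * ((b * m - 1) / (4 * b))) = b * m - (b * m - 1) / 2 := by
      field_simp; ring
    rw [this]; linarith
  obtain ⟨θ, ⟨hθA, hθU⟩, hθ0⟩ := (((eventually_integral_exp_neg_mul_le (h.measurable_A 0)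
    (h.nonneg_A 0) hA (sub_lt_self _ hε0)).and (eventually_integral_exp_neg_mul_le
    (h.measurable_U 0) (h.nonneg_U 0) hU (sub_lt_self _ hε0))).and self_mem_nhdsWithin).exists
  have hθ0 : 0 < θ := hθ0
  set w := (b / β) ^ (1 / (β + 1)) with hw
  have hw0 : 0 < w := by positivity
  have hwcost : b / w + w ^ β = minCost β b := minCost_eq hβ hb0
  obtain ⟨x, hFx, hglim, hgY⟩ := h.exists_level hs hc hLpos hApos hLA hw0 hq0 hq1
  have hdec : 0 < θ * (b * (m - 2 * ε) - 1) := mul_pos hθ0 (by linarith)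
  filter_upwards [hgY, hFx, hs.tendsto_Y.eventually_gt_atTop 0, hs.div_Y,
    hs.tendsto_r.eventually_gt_atTop 0, hglim.eventually_lt_const (sub_pos.2 hq1),
    hs.eventually_mul_r_le ((q ^ 3)⁻¹ * (b / w) + 1) hdec,
    hs.tendsto_r.eventually_ge_atTop 1, eventually_gt_atTop 0,
    hs.eventually_mul_exp_neg_le hκ2 2,
    eventually_ge_atTop (1 / (b / q - b))] with t h1 h2 hY h3 hr h4 h5 h6 ht h7 h8
  set n := ⌈b * t⌉₊ with hn
  set g := tailProb μ (A 0) (x t) with hg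
  have hn1 : b * t ≤ n := Nat.le_ceil _
  have hn2 : (n : ℝ) ≤ b * t / q := by
    have h9 : (n : ℝ) < b * t + 1 := Nat.ceil_lt_add_one (by positivity)
    have h10 : 0 < b / q - b := by
      rw [sub_pos, lt_div_iff₀ hq0]; exact mul_lt_of_lt_one_right hb0 hq1
    rw [div_le_iff₀ h10] at h8
    have : b * t / q = b / q * t := by ring
    rw [this]
    linarith
  have hg0 : 0 < g := hApos _
  -- The three factors 1/q come from n ≤ b t / q, from G(x) ≤ 1/(q w Y), and from 1 - g ≥ exp(-g/q),
  -- valid as g < 1 - q.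
  have hpow : Real.exp (-((q ^ 3)⁻¹ * (b / w) * r t)) ≤ (1 - g) ^ n := by
    have e1 : Real.exp (-(g / q)) ≤ 1 - g := by
      have e2 : 0 < 1 - g := by linarith
      have e3 : (1 - g)⁻¹ ≤ Real.exp (g / q) := by
        have e4 : (1 - g)⁻¹ = g / (1 - g) + 1 := by field_simp; ring
        rw [e4]
        refine le_trans (Real.add_one_le_exp _) (Real.exp_le_exp.2 ?_)
        gcongr
        linarith
      rw [Real.exp_neg]
      exact inv_le_of_inv_le₀ e2 e3
    have e5 : n * (g / q) ≤ (q ^ 3)⁻¹ * (b / w) * r t := by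
      have e6 : g ≤ (q * w * Y t)⁻¹ := by
        rw [le_inv_comm₀ hg0 (by positivity)]; exact h1
      calc n * (g / q) ≤ b * t / q * ((q * w * Y t)⁻¹ / q) := by gcongr
        _ = (q ^ 3)⁻¹ * (b / w) * (t / Y t) := by field_simp
        _ = _ := by rw [h3]
    calc Real.exp (-((q ^ 3)⁻¹ * (b / w) * r t)) ≤ Real.exp (n * (-(g / q))) := by
          rw [Real.exp_le_exp]; linarith
      _ = Real.exp (-(g / q)) ^ n := Real.exp_nat_mul _ _
      _ ≤ (1 - g) ^ n := pow_le_pow_left₀ (Real.exp_pos _).le e1 n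
  have hsum : μ.real {ω | ∑ i ∈ Finset.Icc 1 n, (A i ω + U i ω) ≤ t} ≤
      1 / 2 * Real.exp (-((q ^ 3)⁻¹ * (b / w) * r t)) := by
    refine (h.measureReal_sum_le_le hθ0.le hθA hθU n t).trans ?_
    have e1 : θ * t - n * (θ * (∫ ω, A 0 ω ∂μ - ε + (∫ ω, U 0 ω ∂μ - ε))) ≤
        -(θ * (b * (m - 2 * ε) - 1) * t) := by
      have e2 : 0 < m - 2 * ε := (mul_pos_iff_of_pos_left hb0).1 (one_pos.trans hε)
      have e3 : ∫ ω, A 0 ω ∂μ - ε + (∫ ω, U 0 ω ∂μ - ε) = m - 2 * ε := by rw [hmdef]; ring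
      rw [e3]
      have e4 := mul_le_mul_of_nonneg_right hn1 (mul_pos hθ0 e2).le
      linarith
    have e4 : Real.exp (-1) ≤ 1 / 2 := by
      rw [Real.exp_neg, one_div]
      exact inv_anti₀ two_pos (by linarith [Real.add_one_le_exp (1 : ℝ)])
    calc Real.exp _ ≤ Real.exp (-1 + -((q ^ 3)⁻¹ * (b / w) * r t)) := by
          rw [Real.exp_le_exp]; linarith
      _ = Real.exp (-1) * Real.exp (-((q ^ 3)⁻¹ * (b / w) * r t)) := Real.exp_add _ _
      _ ≤ _ := by gcongr
  have hmain := h.le_measureReal_totalTime n ht.le (x t)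
  refine le_trans ?_ hmain
  calc Real.exp (-(κ * r t)) ≤ 1 / 2 * Real.exp (-(κ' * r t)) := by
        linarith
    _ ≤ 1 / 2 * Real.exp (-(w ^ β * r t) + -((q ^ 3)⁻¹ * (b / w) * r t)) := by
        gcongr
        have e1 : 1 ≤ (q ^ 3)⁻¹ := (one_le_inv₀ (by positivity)).2 (pow_le_one₀ hq0.le hq1.le)
        have e2 : 0 < w ^ β := by positivity
        have e3 : w ^ β + (q ^ 3)⁻¹ * (b / w) ≤ κ' := by
          refine le_trans ?_ hqκ
          rw [← hwcost, mul_add, add_comm]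
          gcongr
          exact le_mul_of_one_le_left e2.le e1
        have e4 := mul_le_mul_of_nonneg_right e3 hr.le
        linarith
    _ = Real.exp (-(w ^ β * r t)) * (Real.exp (-((q ^ 3)⁻¹ * (b / w) * r t)) -
          1 / 2 * Real.exp (-((q ^ 3)⁻¹ * (b / w) * r t))) := by
        rw [Real.exp_add]; ring
    _ ≤ _ := by
        rw [h2]
        gcongr

end IsRetransmissionModel

/-! ### Asymptotic upper bound for the tail of T. -/

namespace IsRetransmissionModel

variable {Ω : Type*} [MeasurableSpace Ω] {μ : Measure Ω} [IsProbabilityMeasure μ]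
  {L : Ω → ℝ} {A U : ℕ → Ω → ℝ} {β x₀ : ℝ} {R Y r : ℝ → ℝ}

/-- For large x, log(1/F(x)) ≥ s R (1/G(x)) and the cost bound applies at y = 1/G(x). For x ≤ x₁,
G(x) ≥ G(x₁) > 0, so n G(x) is already linear in t and exceeds κ r. -/
theorem exists_forall_le_cost (h : IsRetransmissionModel μ L A U)
    (hs : IsCostScale β x₀ R Y r)
    (hLpos : ∀ x, 0 < tailProb μ L x) (hApos : ∀ x, 0 < tailProb μ (A 0) x)
    (hLA : Tendsto (fun x => Real.log (tailProb μ L x)⁻¹ / R (tailProb μ (A 0) x)⁻¹) atTop (𝓝 1))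
    {b κ : ℝ} (hb : 0 < b) (hκ0 : 0 < κ) (hκ : κ < minCost β b) :
    ∃ s : ℝ, 0 < s ∧ s < 1 ∧ ∀ᶠ t in atTop, ∀ n : ℕ, b * t ≤ n → ∀ x,
      κ * r t ≤ n * tailProb μ (A 0) x + s * Real.log (tailProb μ L x)⁻¹ := by
  have hβ := hs.beta_pos
  obtain ⟨κ₂, hκ1, hκ2⟩ := exists_between hκ
  have hκ₂0 : 0 < κ₂ := hκ0.trans hκ1
  -- One factor s is the weight of the logarithm, the other is lost in comparing it with R.
  set s := Real.sqrt (κ / κ₂) with hsdef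
  have hs0 : 0 < s := by positivity
  have hs1 : s < 1 := by
    rw [hsdef, Real.sqrt_lt' one_pos, one_pow, div_lt_one hκ₂0]; exact hκ1
  have hss : s * s * κ₂ = κ := by
    rw [hsdef, Real.mul_self_sqrt (by positivity), div_mul_cancel₀ _ hκ₂0.ne']
  refine ⟨s, hs0, hs1, ?_⟩
  have hginv : Tendsto (fun x => (tailProb μ (A 0) x)⁻¹) atTop atTop :=
    tendsto_inv_nhdsGT_zero.comp (tendsto_nhdsWithin_iff.2
      ⟨tendsto_tailProb_atTop (h.measurable_A 0), Eventually.of_forall hApos⟩)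
  obtain ⟨x₁, hx₁⟩ := eventually_atTop.1
    ((hLA.eventually_const_lt hs1).and (hginv.eventually_ge_atTop x₀))
  filter_upwards [eventually_forall_le_cost hβ hs.mono hs.pos hs.tendsto_ratio hs.tendsto_Y
    hs.div_Y hs.tendsto_R_Y hb hκ₂0 hκ2, eventually_gt_atTop 0,
    hs.eventually_mul_r_le κ (mul_pos hb (hApos x₁))] with t h1 ht h2 n hn x
  rcases le_total x₁ x with hx | hx
  · obtain ⟨h3, h4⟩ := hx₁ x hx
    have h5 := hs.pos _ h4
    rw [lt_div_iff₀ h5] at h3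
    have h6 := h1 _ h4 (inv_pos.2 (hApos x))
    rw [div_inv_eq_mul] at h6
    have h7 : 0 ≤ b * t * tailProb μ (A 0) x := by have := hApos x; positivity
    have h8 : s * s * (b * t * tailProb μ (A 0) x) ≤ 1 * (b * t * tailProb μ (A 0) x) :=
      mul_le_mul_of_nonneg_right (mul_le_one₀ hs1.le hs0.le hs1.le) h7
    calc κ * r t = s * s * (κ₂ * r t) := by rw [← hss]; ring
      _ ≤ s * s * (b * t * tailProb μ (A 0) x + R (tailProb μ (A 0) x)⁻¹) := by gcongr
      _ ≤ b * t * tailProb μ (A 0) x + s * (s * R (tailProb μ (A 0) x)⁻¹) := by linarith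
      _ ≤ _ := by have := (hApos x).le; gcongr
  · have h3 := tailProb_antitone (μ := μ) (A 0) hx
    have h4 : 0 ≤ Real.log (tailProb μ L x)⁻¹ :=
      Real.log_nonneg ((one_le_inv₀ (hLpos x)).2 (tailProb_le_one L x))
    calc κ * r t ≤ b * t * tailProb μ (A 0) x₁ := by linarith
      _ ≤ n * tailProb μ (A 0) x := by have := (hApos x₁).le; gcongr
      _ ≤ _ := le_add_of_nonneg_right (by positivity)

theorem eventually_measureReal_totalTime_le (h : IsRetransmissionModel μ L A U)
    (hs : IsCostScale β x₀ R Y r) (hc : Continuous (tailProb μ L))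
    (hLpos : ∀ x, 0 < tailProb μ L x) (hApos : ∀ x, 0 < tailProb μ (A 0) x)
    (hLA : Tendsto (fun x => Real.log (tailProb μ L x)⁻¹ / R (tailProb μ (A 0) x)⁻¹) atTop (𝓝 1))
    (hA : Integrable (A 0) μ) (hU : Integrable (U 0) μ)
    (hm : 0 < ∫ ω, A 0 ω ∂μ + ∫ ω, U 0 ω ∂μ) {γ ξ ζ : ℝ}
    (hγ : β / (β + 1) < γ) (hγ1 : γ < 1) (hξ : β / (β + 1) < ξ) (hζ0 : 0 ≤ ζ) (hζ1 : ζ < 1)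
    (hξζ : (1 - ζ) * β < ξ)
    (hU_tail : tailProb μ (U 0) =O[atTop] fun x : ℝ => Real.exp (-(x ^ γ)))
    (hL_tail : tailProb μ L =O[atTop] fun x : ℝ => Real.exp (-(x ^ ξ)))
    (hA_tail : tailProb μ (A 0) =O[atTop] fun x : ℝ => Real.exp (-(x ^ ζ))) {κ : ℝ}
    (hκ0 : 0 < κ) (hκ : κ < minCost β (∫ ω, A 0 ω ∂μ + ∫ ω, U 0 ω ∂μ)⁻¹) :
    ∀ᶠ t in atTop, μ.real {ω | ENNReal.ofReal t < totalTime L A U ω} ≤ Real.exp (-(κ * r t)) := by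
  have hβ := hs.beta_pos
  have hβ1 : 0 < β + 1 := by linarith
  set a := ∫ ω, A 0 ω ∂μ with ha
  set u := ∫ ω, U 0 ω ∂μ with hu
  obtain ⟨b, hb0, hbm, hbκ⟩ : ∃ b, 0 < b ∧ b < (a + u)⁻¹ ∧ κ < minCost β b := by
    have h1 : ∀ᶠ b in 𝓝[<] (a + u)⁻¹, κ < minCost β b :=
      ((continuousAt_minCost (inv_pos.2 hm)).eventually_const_lt hκ).filter_mono nhdsWithin_le_nhds
    obtain ⟨b, h2, h3⟩ := (h1.and (Ioo_mem_nhdsLT (inv_pos.2 hm))).exists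
    exact ⟨b, h3.1, h3.2, h2⟩
  obtain ⟨κ₁, hκ1, hκ2⟩ := exists_between hbκ
  obtain ⟨ε, hε0, hε⟩ : ∃ ε : ℝ, 0 < ε ∧ b * (a + u + 4 * ε) < 1 := by
    have h1 : b * (a + u) < 1 := by rwa [← one_div, lt_div_iff₀ hm] at hbm
    refine ⟨(1 - b * (a + u)) / (8 * b), div_pos (by linarith) (by linarith), ?_⟩
    have : b * (a + u + 4 * ((1 - b * (a + u)) / (8 * b))) =
        b * (a + u) + (1 - b * (a + u)) / 2 := by
      field_simp; ring
    rw [this]; linarith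
  have hξ0 : 0 < ξ := lt_trans (by positivity) hξ
  -- the data unit is cut off at `t ^ (p / ξ)`
  obtain ⟨p, hp0, hpξ, hpζ⟩ : ∃ p, β / (β + 1) < p ∧ p / ξ < 1 ∧
      β / (β + 1) < 1 + p / ξ * (ζ - 1) := by
    have h1 : ∀ᶠ p in 𝓝 (β / (β + 1)), p / ξ < 1 :=
      ((continuous_id.div_const ξ).tendsto (β / (β + 1))).eventually_lt_const
        ((div_lt_one hξ0).2 hξ)
    have hc2 : Continuous fun p : ℝ => 1 + p / ξ * (ζ - 1) := by fun_prop
    have h2 : ∀ᶠ p in 𝓝 (β / (β + 1)), β / (β + 1) < 1 + p / ξ * (ζ - 1) := by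
      refine (hc2.tendsto (β / (β + 1))).eventually_const_lt ?_
      -- At p = β/(β+1) the required inequality is exactly (1 - ζ) β < ξ; by continuity it survives
      -- for p slightly larger.
      have e1 : (1 - ζ) * β / (ξ * (β + 1)) < 1 / (β + 1) := by
        rw [div_lt_div_iff₀ (by positivity) hβ1]
        nlinarith
      have e2 : β / (β + 1) = 1 - 1 / (β + 1) := by field_simp; ring
      have e3 : β / (β + 1) / ξ * (ζ - 1) = -((1 - ζ) * β / (ξ * (β + 1))) := by
        field_simp; ring
      rw [e3, e2]; linarith
    obtain ⟨p, ⟨h3, h4⟩, h5⟩ := (((h1.and h2).filter_mono nhdsWithin_le_nhds).and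
      (self_mem_nhdsWithin : Ioi (β / (β + 1)) ∈ 𝓝[>] (β / (β + 1)))).exists
    exact ⟨p, h5, h3, h4⟩
  obtain ⟨s, hs0, hs1, hcost⟩ := h.exists_forall_le_cost hs hLpos hApos hLA hb0
    (hκ0.trans hκ1) hκ2
  obtain ⟨sA, hsA0, hsA⟩ := exists_measureReal_sum_truncated_le h.measurable_A h.nonneg_A h.indep_A
    h.identDistrib_A hA hζ0 hζ1 hA_tail hε0
  obtain ⟨sU, hsU0, hsU⟩ := exists_measureReal_sum_truncated_le h.measurable_U h.nonneg_U h.indep_U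
    h.identDistrib_U hU (lt_trans (by positivity) hγ).le hγ1 hU_tail hε0
  obtain ⟨CL, hCL0, hCL⟩ := hL_tail.exists_pos
  obtain ⟨CU, hCU0, hCU⟩ := hU_tail.exists_pos
  have hp00 : 0 < p := lt_trans (by positivity) hp0
  have hx : Tendsto (fun t : ℝ => t ^ (p / ξ)) atTop atTop := tendsto_rpow_atTop (by positivity)
  have hCL' := hx.eventually hCL.bound
  have hslack : 0 < 1 - b * (a + u + 4 * ε) := by linarith
  -- The margin between b (a + u + 4 ε) and 1 pays for the final transmission, of length at most
  -- t^(p/ξ), and for rounding n up.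
  have hlin : ∀ᶠ t : ℝ in atTop, t ^ (p / ξ) + (a + u + 4 * ε) ≤
      (1 - b * (a + u + 4 * ε)) * t := by
    have h1 : (fun t : ℝ => t ^ (p / ξ) + (a + u + 4 * ε)) =o[atTop] fun t : ℝ => t := by
      refine Asymptotics.IsLittleO.add ?_ (Asymptotics.isLittleO_const_id_atTop _)
      refine (Asymptotics.isLittleO_iff_tendsto' ((eventually_gt_atTop 0).mono
        fun t ht h0 => absurd h0 ht.ne')).2 ?_
      refine (tendsto_rpow_neg_atTop (sub_pos.2 hpξ)).congr' ?_
      filter_upwards [eventually_gt_atTop 0] with t ht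
      rw [neg_sub, Real.rpow_sub_one ht.ne']
    filter_upwards [h1.bound hslack, eventually_ge_atTop 0] with t ht ht0
    rw [Real.norm_of_nonneg ht0] at ht
    exact (le_abs_self _).trans ht
  filter_upwards [hcost, hCL', hCU.bound, hlin, eventually_ge_atTop 1,
    hs.eventually_mul_exp_neg_le hκ1 (5 * ∫ ω, tailProb μ L (L ω) ^ (-s) ∂μ),
    hs.eventually_exp_neg_le hp0 one_pos (5 * CL) κ,
    hs.eventually_exp_neg_le hγ one_pos (5 * ((b + 1) * CU)) κ,
    hs.eventually_exp_neg_le hpζ (by positivity : 0 < sA * ε * b) 5 κ,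
    hs.eventually_exp_neg_le hγ (by positivity : 0 < sU * ε * b) 5 κ]
    with t hcost hL hU' hlin ht e1 e2 e3 e4 e5
  have ht0 : 0 < t := by linarith
  set n := ⌈b * t⌉₊ with hn
  have hn1 : b * t ≤ n := Nat.le_ceil _
  have hn2 : (n : ℝ) ≤ b * t + 1 := (Nat.ceil_lt_add_one (by positivity)).le
  set x := t ^ (p / ξ) with hxdef
  have hx0 : 0 < x := Real.rpow_pos_of_pos ht0 _
  have hmain := h.measureReal_totalTime_le n (t := t) (x := x) (y := t) (a := a + 2 * ε)
    (u := u + 2 * ε) hx0.le (by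
      have h1 := mul_le_mul_of_nonneg_right hn2 (by positivity : 0 ≤ a + u + 4 * ε)
      linarith)
  refine hmain.trans ?_
  -- Each of the five terms of the union bound is at most one fifth of exp(-κ r).
  have t1 : 5 * μ.real {ω | ∀ i ∈ Finset.Icc 1 n, A i ω < L ω} ≤ Real.exp (-(κ * r t)) := by
    refine le_trans ?_ e1
    rw [mul_assoc]
    exact mul_le_mul_of_nonneg_left
      (h.measureReal_forall_lt_L_le hc hLpos n hs0 hs1 (hcost n hn1)) (by norm_num)
  have t2 : 5 * tailProb μ L x ≤ Real.exp (-(κ * r t)) := by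
    refine le_trans ?_ e2
    rw [Real.norm_of_nonneg (tailProb_nonneg _ _), Real.norm_of_nonneg (Real.exp_pos _).le,
      ← Real.rpow_mul ht0.le, div_mul_cancel₀ _ hξ0.ne'] at hL
    have h2 : 1 * Real.exp (-(t ^ p)) ≤ (t + 1) * Real.exp (-(t ^ p)) := by gcongr; linarith
    rw [one_mul]
    calc 5 * tailProb μ L x ≤ 5 * (CL * (1 * Real.exp (-(t ^ p)))) := by rw [one_mul]; gcongr
      _ ≤ 5 * (CL * ((t + 1) * Real.exp (-(t ^ p)))) := by gcongr
      _ = _ := by ring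
  have t3 : 5 * (n * tailProb μ (U 0) t) ≤ Real.exp (-(κ * r t)) := by
    refine le_trans ?_ e3
    rw [Real.norm_of_nonneg (tailProb_nonneg _ _), Real.norm_of_nonneg (Real.exp_pos _).le] at hU'
    rw [one_mul]
    have h2 : (n : ℝ) ≤ (b + 1) * (t + 1) := by linarith
    calc 5 * (n * tailProb μ (U 0) t) ≤ 5 * (((b + 1) * (t + 1)) *
          (CU * Real.exp (-(t ^ γ)))) := by
          have := tailProb_nonneg (μ := μ) (U 0) t
          gcongr
      _ = _ := by ring
  have t45 : ∀ c q : ℝ, c * b * t ^ (1 + q) ≤ c * t ^ q * n ∨ c < 0 := by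
    intro c q
    rcases lt_or_ge c 0 with hc0 | hc0
    · exact Or.inr hc0
    left
    rw [Real.rpow_add ht0, Real.rpow_one]
    calc c * b * (t * t ^ q) = c * t ^ q * (b * t) := by ring
      _ ≤ c * t ^ q * n := by gcongr
  have t4 : 5 * μ.real {ω | n * (a + 2 * ε) ≤
      ∑ i ∈ Finset.Icc 1 n, (Iic x).indicator id (A i ω)} ≤ Real.exp (-(κ * r t)) := by
    refine le_trans ?_ e4
    have h2 := (t45 (sA * ε) (p / ξ * (ζ - 1))).resolve_right (by have := mul_pos hsA0 hε0; linarith)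
    have h3 : x ^ (ζ - 1) = t ^ (p / ξ * (ζ - 1)) := (Real.rpow_mul ht0.le _ _).symm
    have h4 := hsA n x hx0
    rw [h3] at h4
    calc _ ≤ 5 * Real.exp (-(sA * t ^ (p / ξ * (ζ - 1)) * ε * n)) := by gcongr
      _ ≤ 5 * Real.exp (-(sA * ε * b * t ^ (1 + p / ξ * (ζ - 1)))) := by
          gcongr 5 * Real.exp ?_
          linarith
      _ ≤ _ := by
          gcongr
          linarith
  have t5 : 5 * μ.real {ω | n * (u + 2 * ε) ≤
      ∑ i ∈ Finset.Icc 1 n, (Iic t).indicator id (U i ω)} ≤ Real.exp (-(κ * r t)) := by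
    refine le_trans ?_ e5
    have h2 := (t45 (sU * ε) (γ - 1)).resolve_right (by have := mul_pos hsU0 hε0; linarith)
    rw [add_sub_cancel] at h2
    have h4 := hsU n t ht0
    calc _ ≤ 5 * Real.exp (-(sU * t ^ (γ - 1) * ε * n)) := by gcongr
      _ ≤ 5 * Real.exp (-(sU * ε * b * t ^ γ)) := by
          gcongr 5 * Real.exp ?_
          linarith
      _ ≤ _ := by
          gcongr
          linarith
  linarith

end IsRetransmissionModel

/-! ### The main theorem. -/

theorem isBigO_exp_neg_rpow_of_le {f : ℝ → ℝ} {p q : ℝ} (hpq : q ≤ p)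
    (hf : f =O[atTop] fun x : ℝ => Real.exp (-(x ^ p))) :
    f =O[atTop] fun x : ℝ => Real.exp (-(x ^ q)) := by
  refine hf.trans (Asymptotics.IsBigO.of_bound 1 ?_)
  filter_upwards [eventually_ge_atTop 1] with x hx
  rw [Real.norm_of_nonneg (Real.exp_pos _).le, Real.norm_of_nonneg (Real.exp_pos _).le, one_mul,
    Real.exp_le_exp, neg_le_neg_iff]
  exact Real.rpow_le_rpow_of_exponent_le hx hpq

theorem theorem2p7 {Ω : Type*} [MeasurableSpace Ω] (μ : Measure Ω) [IsProbabilityMeasure μ]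
    (L : Ω → ℝ) (A U : ℕ → Ω → ℝ) (hmodel : IsRetransmissionModel μ L A U)
    -- the tail of `L` is continuous and has unbounded support
    (hL_cont : Continuous (tailProb μ L)) (hL_pos : ∀ x : ℝ, 0 ≤ x → 0 < tailProb μ L x)
    (Φ R l : ℝ → ℝ) (β : ℝ) (hβ : 0 < β)
    (hΦ : ∀ x : ℝ, 0 < x → Φ x = Real.exp (R x))
    (hR : ∀ x : ℝ, 0 < x → R x = x ^ β * l x)
    (hΦ_mono : ∃ x₀ : ℝ, MonotoneOn Φ (Ici x₀))
    (hR_rv : IsRegularlyVarying R β)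
    (hLA : Tendsto (fun x : ℝ =>
      Real.log (tailProb μ L x)⁻¹ / Real.log (Φ (tailProb μ (A 0) x)⁻¹)) atTop (𝓝 1))
    (hl : Tendsto (fun x : ℝ => l ((x / l x) ^ (1 / (1 + β))) / l x) atTop (𝓝 1))
    (hA_int : Integrable (A 0) μ)
    (δ : ℝ) (hδ : 0 < δ)
    (hU_tail : tailProb μ (U 0) =O[atTop]
      fun x : ℝ => Real.exp (-((Real.log (Φ x)) ^ ((1 + δ) / (β + 1)))))
    (ξ ζ : ℝ) (hξ : β / (β + 1) < ξ) (hζ : 0 ≤ ζ) (hξζ : (1 - ζ) * β < ξ)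
    (hL_tail : tailProb μ L =O[atTop] fun x : ℝ => Real.exp (-(x ^ ξ)))
    (hA_tail : tailProb μ (A 0) =O[atTop] fun x : ℝ => Real.exp (-(x ^ ζ))) :
    Integrable (fun ω => A 0 ω + U 0 ω) μ ∧
      Tendsto (fun t : ℝ =>
        Real.log (μ.real {ω | ENNReal.ofReal t < totalTime L A U ω})⁻¹ /
          (Real.log (Φ t)) ^ (1 / (β + 1)))
        atTop
        (𝓝 ((β ^ (1 / (β + 1)) + β ^ (-β / (β + 1))) /
          (∫ ω, (A 0 ω + U 0 ω) ∂μ) ^ (β / (β + 1)))) := by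
  have hβ1 : 0 < β + 1 := by linarith
  obtain ⟨x₀, Y, hs⟩ := exists_isCostScale hβ hΦ hR hΦ_mono hR_rv hl
  have hLpos : ∀ x, 0 < tailProb μ L x := fun x =>
    (hL_pos _ (le_max_right x 0)).trans_le (tailProb_antitone L (le_max_left x 0))
  -- the ratio in `hLA` could not converge to `1` if `A` were bounded
  have hApos : ∀ x, 0 < tailProb μ (A 0) x := by
    intro x
    by_contra hx
    have hz : ∀ y, x ≤ y → tailProb μ (A 0) y = 0 := fun y hy =>
      le_antisymm ((tailProb_antitone (A 0) hy).trans (not_lt.1 hx)) (tailProb_nonneg _ _)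
    -- Where the tail of A vanishes, 0⁻¹ = 0 makes the denominator the constant log Φ(0), so
    -- log(1/F) would converge, although it diverges.
    have h1 : Tendsto (fun y => Real.log (tailProb μ L y)⁻¹) atTop
        (𝓝 (1 * Real.log (Φ (0 : ℝ)⁻¹))) := by
      refine (hLA.mul_const _).congr' ?_
      filter_upwards [eventually_ge_atTop x, hLA.eventually_ne one_ne_zero] with y hy hne
      rw [hz y hy] at hne ⊢
      exact div_mul_cancel₀ _ fun h0 => hne (by rw [h0, div_zero])
    have h2 : Tendsto (fun y => Real.log (tailProb μ L y)⁻¹) atTop atTop :=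
      Real.tendsto_log_atTop.comp (tendsto_inv_nhdsGT_zero.comp (tendsto_nhdsWithin_iff.2
        ⟨tendsto_tailProb_atTop hmodel.measurable_L, Eventually.of_forall hLpos⟩))
    exact not_tendsto_nhds_of_tendsto_atTop h2 _ h1
  have hLA' : Tendsto (fun x => Real.log (tailProb μ L x)⁻¹ / R (tailProb μ (A 0) x)⁻¹) atTop
      (𝓝 1) := by
    refine hLA.congr fun x => ?_
    rw [hΦ _ (inv_pos.2 (hApos x)), Real.log_exp]
  -- the tails in terms of Weibull tails with exponents in `[0, 1)`
  obtain ⟨γ, hγ, hγ1, hU_tail'⟩ : ∃ γ, β / (β + 1) < γ ∧ γ < 1 ∧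
      tailProb μ (U 0) =O[atTop] fun x : ℝ => Real.exp (-(x ^ γ)) := by
    have h0 : β / (β + 1) < min 1 (β / (β + 1) * (1 + δ)) :=
      lt_min ((div_lt_one hβ1).2 (by linarith)) (lt_mul_of_one_lt_right (by positivity)
        (by linarith))
    obtain ⟨γ, h1, h2⟩ := exists_between h0
    have hγ0 : 0 < γ := lt_trans (by positivity) h1
    refine ⟨γ, h1, h2.trans_le (min_le_left _ _), hU_tail.trans (.of_bound 1 ?_)⟩
    have h3 : γ * (β + 1) / (1 + δ) < β := by
      have h4 := h2.trans_le (min_le_right _ _)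
      rw [div_mul_eq_mul_div, lt_div_iff₀ hβ1] at h4
      rwa [div_lt_iff₀ (by linarith)]
    filter_upwards [eventually_rpow_le_of_tendsto_ratio hs.mono hs.pos hs.tendsto_ratio
      (by positivity) h3, eventually_gt_atTop 0] with x hx hx0
    rw [Real.norm_of_nonneg (Real.exp_pos _).le, Real.norm_of_nonneg (Real.exp_pos _).le, one_mul,
      Real.exp_le_exp, neg_le_neg_iff, hΦ x hx0, Real.log_exp]
    calc x ^ γ = (x ^ (γ * (β + 1) / (1 + δ))) ^ ((1 + δ) / (β + 1)) := by
          rw [← Real.rpow_mul hx0.le]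
          congr 1
          field_simp
      _ ≤ R x ^ ((1 + δ) / (β + 1)) := Real.rpow_le_rpow (by positivity) hx (by positivity)
  obtain ⟨ζ', hζ'0, hζ'1, hξζ', hA_tail'⟩ : ∃ ζ', 0 ≤ ζ' ∧ ζ' < 1 ∧ (1 - ζ') * β < ξ ∧
      tailProb μ (A 0) =O[atTop] fun x : ℝ => Real.exp (-(x ^ ζ')) := by
    rcases lt_or_ge ζ 1 with h1 | h1
    · exact ⟨ζ, hζ, h1, hξζ, hA_tail⟩
    have hξ0 : 0 < ξ := lt_trans (by positivity) hξ
    have h2 : max 0 (1 - ξ / β) < 1 := max_lt one_pos (by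
      have : 0 < ξ / β := by positivity
      linarith)
    -- The truncation argument needs an exponent below 1; any ζ' in (1 - ξ/β, 1) keeps (1 - ζ') β <
    -- ξ.
    obtain ⟨ζ', h3, h4⟩ := exists_between h2
    refine ⟨ζ', (le_max_left _ _).trans h3.le, h4, ?_,
      isBigO_exp_neg_rpow_of_le (h4.le.trans h1) hA_tail⟩
    have h5 := (le_max_right _ _).trans_lt h3
    rw [sub_lt_comm, lt_div_iff₀ hβ] at h5
    exact h5
  have hU_int : Integrable (U 0) μ := integrable_of_tailProb_isBigO (hmodel.measurable_U 0)
    (hmodel.nonneg_U 0) (lt_trans (by positivity) hγ) hU_tail'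
  refine ⟨hA_int.add hU_int, ?_⟩
  rw [integral_add hA_int hU_int]
  have hm : 0 < ∫ ω, A 0 ω ∂μ + ∫ ω, U 0 ω ∂μ := by
    refine add_pos_of_pos_of_nonneg ?_ (integral_nonneg_of_ae (hmodel.nonneg_U 0))
    rw [integral_pos_iff_support_of_nonneg_ae (hmodel.nonneg_A 0) hA_int]
    have h1 : 0 < μ {ω | 0 < A 0 ω} := (ENNReal.toReal_pos_iff.1 (hApos 0)).1
    exact h1.trans_le (measure_mono fun ω hω => ne_of_gt hω)
  have hlimit : (β ^ (1 / (β + 1)) + β ^ (-β / (β + 1))) /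
      (∫ ω, A 0 ω ∂μ + ∫ ω, U 0 ω ∂μ) ^ (β / (β + 1)) =
        minCost β (∫ ω, A 0 ω ∂μ + ∫ ω, U 0 ω ∂μ)⁻¹ := by
    rw [minCost, Real.inv_rpow hm.le, div_eq_inv_mul]
  rw [hlimit]
  have hden : ∀ᶠ t in atTop, 0 < R t ^ (1 / (β + 1)) ∧
      Real.log (Φ t) ^ (1 / (β + 1)) = R t ^ (1 / (β + 1)) := by
    filter_upwards [hs.tendsto_r.eventually_gt_atTop 0, eventually_gt_atTop 0] with t h1 h2
    exact ⟨h1, by rw [hΦ t h2, Real.log_exp]⟩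
  have hTpos : ∀ᶠ t in atTop, 0 < μ.real {ω | ENNReal.ofReal t < totalTime L A U ω} := by
    filter_upwards [hmodel.eventually_le_measureReal_totalTime hs hL_cont hLpos hApos hLA' hA_int
      hU_int hm (lt_add_one _)] with t ht using (Real.exp_pos _).trans_le ht
  refine tendsto_order.2 ⟨fun κ hκ => ?_, fun κ hκ => ?_⟩
  -- The maximum with 0 is taken because the upper bound is available only for positive rates, while
  -- κ may be negative.
  · obtain ⟨κ', h1, h2⟩ := exists_between (max_lt hκ (minCost_pos hβ (inv_pos.2 hm)))
    filter_upwards [hmodel.eventually_measureReal_totalTime_le hs hL_cont hLpos hApos hLA' hA_int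
      hU_int hm hγ hγ1 hξ hζ'0 hζ'1 hξζ' hU_tail' hL_tail hA_tail'
      ((le_max_right _ _).trans_lt h1) h2, hden, hTpos] with t h3 h4 h5
    rw [h4.2, lt_div_iff₀ h4.1, Real.log_inv]
    have h6 := (Real.log_le_iff_le_exp h5).2 h3
    have h7 := mul_lt_mul_of_pos_right ((le_max_left _ _).trans_lt h1) h4.1
    linarith
  · obtain ⟨κ', h1, h2⟩ := exists_between hκ
    filter_upwards [hmodel.eventually_le_measureReal_totalTime hs hL_cont hLpos hApos hLA' hA_int
      hU_int hm h1, hden, hTpos] with t h3 h4 h5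
    rw [h4.2, div_lt_iff₀ h4.1, Real.log_inv]
    have h6 := (Real.le_log_iff_exp_le h5).2 h3
    have h7 := mul_lt_mul_of_pos_right h2 h4.1
    linarith
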